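/- For $\alpha>0$ and $z$ in the upper half-plane $\mathbb{H}=\{z=x+iy : y>0\}$ let $$M(\alpha,z)=\sum_{(m,n)\in\mathbb{Z}^2}\frac{|mz+n|^2}{\Im(z)}\,e^{-\pi\alpha\frac{|mz+n|^2}{\Im(z)}}.$$ Let $\mathcal{D}_{\mathcal{G}}=\{z\in\mathbb{H} : |z|>1,\ 0<\Re(z)<\tfrac12\}$, with closure $\overline{\mathcal{D}_{\mathcal{G}}}$ in $\mathbb{H}$, and let $\Gamma=\Gamma_a\cup\Gamma_b$, where $$\Gamma_a=\{iy : y\ge 1\},\qquad \Gamma_b=\{e^{i\theta} : \theta\in[\tfrac{\pi}{3},\tfrac{\pi}{2}]\}.$$ Then for every $\alpha\in(0,\,0.9155730607)$ the following three minima exist (are attained) and are equal: $$\min_{z\in\mathbb{H}}M(\alpha,z)=\min_{z\in\overline{\mathcal{D}_{\mathcal{G}}}}M(\alpha,z)=\min_{z\in\Gamma}M(\alpha,z).$$ -/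

import Mathlib

open scoped UpperHalfPlane

/-- The lattice sum `M(α, z) = ∑_{(m,n) ∈ ℤ²} (|mz+n|² / Im z) · exp(-πα |mz+n|² / Im z)`,
which is `∑_{P ∈ L} |P|² exp(-πα|P|²)` for the unit-density lattice
`L = (Im z)^{-1/2} (ℤ ⊕ zℤ)`. -/
noncomputable def latticeM (α : ℝ) (z : ℍ) : ℝ :=
  ∑' p : ℤ × ℤ, ‖(p.1 : ℂ) * (z : ℂ) + (p.2 : ℂ)‖ ^ 2 / z.im *
    Real.exp (-Real.pi * α * (‖(p.1 : ℂ) * (z : ℂ) + (p.2 : ℂ)‖ ^ 2 / z.im))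

/-- The series defining `latticeM` converges for every `α > 0`. -/
theorem summable_latticeM {α : ℝ} (hα : 0 < α) (z : ℍ) :
    Summable fun p : ℤ × ℤ => ‖(p.1 : ℂ) * (z : ℂ) + (p.2 : ℂ)‖ ^ 2 / z.im *
      Real.exp (-Real.pi * α * (‖(p.1 : ℂ) * (z : ℂ) + (p.2 : ℂ)‖ ^ 2 / z.im)) := by
  have hc : 0 < Real.pi * α := mul_pos Real.pi_pos hα
  have hs : Summable fun x : ℤ × ℤ => ‖(![x.1, x.2] : Fin 2 → ℤ)‖ ^ (-(4 : ℝ)) :=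
    ((finTwoArrowEquiv ℤ).symm.summable_iff).2
      (EisensteinSeries.summable_one_div_norm_rpow (k := 4) (by norm_num))
  refine Summable.of_nonneg_of_le (fun p => ?_) (fun p => ?_)
    (hs.mul_left (6 / (Real.pi * α) ^ 3 * z.im ^ 2 * EisensteinSeries.r z ^ (-(4 : ℝ))))
  · have := z.im_pos
    positivity
  · have hb := EisensteinSeries.summand_bound z (k := 4) (by norm_num) ![p.1, p.2]
    simp only [Matrix.cons_val_zero, Matrix.cons_val_one] at hb
    set w := ‖(p.1 : ℂ) * (z : ℂ) + (p.2 : ℂ)‖ with hw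
    have hy := z.im_pos
    have hw0 : 0 ≤ w := norm_nonneg _
    rw [mul_assoc _ (EisensteinSeries.r z ^ (-(4 : ℝ)))]
    refine le_trans ?_ (mul_le_mul_of_nonneg_left hb (by positivity))
    rcases hw0.eq_or_lt with h | h
    · rw [← h]; simp
    · have hq : 0 < w ^ 2 / z.im := by positivity
      have he := Real.pow_div_factorial_le_exp (Real.pi * α * (w ^ 2 / z.im)) (by positivity) 3
      have hr : w ^ (-(4 : ℝ)) = (w ^ 4)⁻¹ := by
        rw [Real.rpow_neg hw0]; norm_cast
      rw [hr, neg_mul, neg_mul, Real.exp_neg, ← div_eq_mul_inv,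
        div_le_iff₀ (Real.exp_pos _)]
      calc w ^ 2 / z.im = 6 / (Real.pi * α) ^ 3 * z.im ^ 2 * (w ^ 4)⁻¹ *
            ((Real.pi * α * (w ^ 2 / z.im)) ^ 3 / (Nat.factorial 3 : ℕ)) := by
            have h6 : ((Nat.factorial 3 : ℕ) : ℝ) = 6 := by norm_num [Nat.factorial]
            rw [h6]
            field_simp
        _ ≤ _ := mul_le_mul_of_nonneg_left he (by positivity)

/-- The open right-half fundamental domain `{z ∈ ℍ : |z| > 1, 0 < Re z < 1/2}`. -/
def halfFundamentalDomain : Set ℍ :=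
  {z | 1 < ‖(z : ℂ)‖ ∧ 0 < z.re ∧ z.re < 1 / 2}

/-- The vertical half-line `Γ_a = {iy : y ≥ 1}`. -/
def gammaA : Set ℍ :=
  {z | ∃ y : ℝ, 1 ≤ y ∧ (z : ℂ) = Complex.I * y}

/-- The arc `Γ_b = {e^{iθ} : θ ∈ [π/3, π/2]}`. -/
def gammaB : Set ℍ :=
  {z | ∃ t ∈ Set.Icc (Real.pi / 3) (Real.pi / 2), (z : ℂ) = Complex.exp (Complex.I * t)}

open Real Filter Set Asymptotics MeasureTheory
open scoped FourierTransform Topology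

/-!
Write `X = α Im z` and `Z = Im z / α`. Poisson summation along the rows of the lattice turns
`α² M(α, z)` into `√X ∑ₘₖ (1 / (2π) + X m² - Z k²) exp (-π (X m² + Z k²)) cos (2π m k Re z)`.
By modular invariance and reflection, and since minimizers exist, it is enough to dominate every
point `z` of the closed half fundamental domain by a point of `Γ`.

* If `X ≤ 1 / 4`, the terms with `k = 0` dominate and show that `i / α` has a smaller value.
* If `Z - X < 1 / (2π) - 0.0018`, then `α` is close to the upper bound and `z` to the hexagonal
  point, and the two shortest shells of lattice vectors already exceed `M(α, i)`.
* Otherwise `M(α, ·)` decreases as `z` moves to the left along its horizontal line until it meets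
  `Γ`. The sign is given by the terms with `|m| = |k| = 1`, whose coefficient is negative when
  `ω = Z - X - 1 / (2π)` is positive. When `ω` is small or negative, the line stays close to
  `Re z = 1 / 2`, and there the terms with `|m| = 2`, `|k| = 1` have the right sign and take over.
-/

/-! ### Poisson summation for Gaussians -/

theorem summable_pow_mul_gaussian {a : ℝ} (ha : 0 < a) (j : ℕ) :
    Summable fun n : ℤ => |(n : ℝ)| ^ j * exp (-π * a * (n : ℝ) ^ 2) := by
  refine (summable_pow_mul_jacobiTheta₂_term_bound 0 ha j).congr fun n => ?_
  push_cast
  congr 2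
  ring

theorem integrable_pow_smul_cexp_gaussian {a : ℝ} (ha : 0 < a) (j : ℕ) :
    Integrable fun x : ℝ => x ^ j • Complex.exp (-π * a * (x : ℂ) ^ 2) := by
  have hj : (-1 : ℝ) < j := by linarith [j.cast_nonneg (α := ℝ)]
  refine (integrable_rpow_mul_exp_neg_mul_sq (mul_pos pi_pos ha) hj).ofReal.congr
    (Eventually.of_forall fun x => ?_)
  simp [neg_mul]

theorem iteratedDeriv_two_cexp_neg_mul_sq (K c : ℂ) :
    iteratedDeriv 2 (fun t : ℝ => K * Complex.exp (-c * (t : ℂ) ^ 2)) =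
      fun t : ℝ => K * ((4 * c ^ 2 * (t : ℂ) ^ 2 - 2 * c) * Complex.exp (-c * (t : ℂ) ^ 2)) := by
  have hexp (t : ℝ) : HasDerivAt (fun t : ℝ => Complex.exp (-c * (t : ℂ) ^ 2))
      (-2 * c * t * Complex.exp (-c * (t : ℂ) ^ 2)) t := by
    have h := (((hasDerivAt_id t).ofReal_comp.pow 2).const_mul (-c)).cexp
    convert! h using 1
    simp only [neg_mul, id_eq, Pi.pow_apply, Nat.cast_ofNat, Nat.add_one_sub_one, pow_one,
      Complex.ofReal_one, mul_one, mul_neg, neg_inj]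
    ring
  have hlin (t : ℝ) : HasDerivAt (fun t : ℝ => -2 * c * (t : ℂ)) (-2 * c) t := by
    simpa using (hasDerivAt_id t).ofReal_comp.const_mul (-2 * c)
  rw [iteratedDeriv_succ, iteratedDeriv_one, funext fun t => ((hexp t).const_mul K).deriv]
  funext t
  refine (((hlin t).mul (hexp t)).const_mul K).deriv.trans ?_
  ring

theorem fourier_add_smul {f g : ℝ → ℂ} (hf : Integrable f) (hg : Integrable g) (c d : ℂ) :
    𝓕 (c • f + d • g) = c • 𝓕 f + d • 𝓕 g := by
  funext t
  simp only [Real.fourier_eq, Pi.add_apply, Pi.smul_apply, smul_add, smul_comm _ c, smul_comm _ d]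
  rw [integral_add, integral_smul, integral_smul]
  · exact ((Real.fourierIntegral_convergent_iff t).2 hf).smul c
  · exact ((Real.fourierIntegral_convergent_iff t).2 hg).smul d

theorem cpow_half_ofReal {a : ℝ} (ha : 0 < a) : (a : ℂ) ^ (1 / 2 : ℂ) = (√a : ℝ) := by
  rw [sqrt_eq_rpow, Complex.ofReal_cpow ha.le]
  norm_num

theorem fourier_quadratic_mul_gaussian {a : ℝ} (ha : 0 < a) (u v : ℝ) :
    (𝓕 fun x : ℝ => (((u + v * x ^ 2) * exp (-π * a * x ^ 2) : ℝ) : ℂ)) = fun t : ℝ =>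
      (((√a)⁻¹ * (u + v * (1 / (2 * π * a) - t ^ 2 / a ^ 2)) * exp (-π / a * t ^ 2) : ℝ) : ℂ) := by
  set G : ℝ → ℂ := fun x => Complex.exp (-π * a * (x : ℂ) ^ 2) with hG
  set D : ℝ → ℂ := fun x => (-2 * π * Complex.I * x) ^ 2 • G x with hD
  have hDG : D = fun x : ℝ => (-(4 * π ^ 2) : ℂ) • (x ^ 2 • G x) := by
    funext x
    simp only [hD, smul_eq_mul, Complex.real_smul, Complex.ofReal_pow]
    linear_combination (4 * (π : ℂ) ^ 2 * x ^ 2 * G x) * Complex.I_sq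
  have hIntG : Integrable G := by simpa [hG] using integrable_pow_smul_cexp_gaussian ha 0
  have hIntD : Integrable D := by
    rw [hDG]
    exact (integrable_pow_smul_cexp_gaussian ha 2).smul (-(4 * π ^ 2) : ℂ)
  have hFG : 𝓕 G = fun t : ℝ => ((√a)⁻¹ : ℂ) * Complex.exp (-(π / a) * (t : ℂ) ^ 2) := by
    rw [hG, fourier_gaussian_pi (by simpa using ha), cpow_half_ofReal ha]
    simp only [one_div, neg_div]
  have hFD : 𝓕 D = fun t : ℝ => ((√a)⁻¹ : ℂ) *
      ((4 * (π / a) ^ 2 * (t : ℂ) ^ 2 - 2 * (π / a)) * Complex.exp (-(π / a) * (t : ℂ) ^ 2)) := by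
    rw [hD, ← Real.iteratedDeriv_fourier (N := 2)
      (fun n _ => integrable_pow_smul_cexp_gaussian ha n) le_rfl, ← hG, hFG,
      iteratedDeriv_two_cexp_neg_mul_sq]
  have hpi : (π : ℂ) ≠ 0 := mod_cast pi_ne_zero
  have hac : (a : ℂ) ≠ 0 := mod_cast ha.ne'
  have hsplit : (fun x : ℝ => (((u + v * x ^ 2) * exp (-π * a * x ^ 2) : ℝ) : ℂ)) =
      (u : ℂ) • G + (-(v / (4 * π ^ 2)) : ℂ) • D := by
    funext x
    simp only [hDG, hG, Pi.add_apply, Pi.smul_apply, smul_eq_mul, Complex.real_smul]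
    push_cast
    field_simp
  rw [hsplit, fourier_add_smul hIntG hIntD, hFG, hFD]
  funext t
  simp only [Pi.add_apply, Pi.smul_apply, smul_eq_mul]
  push_cast
  rw [neg_div]
  field_simp
  ring

theorem isBigO_quadratic_mul_gaussian {a : ℝ} (ha : 0 < a) (u v : ℝ) :
    (fun x : ℝ => (u + v * x ^ 2) * exp (-π * a * x ^ 2)) =O[cocompact ℝ]
      fun x : ℝ => |x| ^ (-2 : ℝ) := by
  have hx : Tendsto (fun x : ℝ => |x|) (cocompact ℝ) atTop := tendsto_norm_cocompact_atTop
  have hone : ∀ᶠ x : ℝ in cocompact ℝ, 1 ≤ |x| := hx.eventually_ge_atTop 1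
  have hpoly : (fun x : ℝ => u + v * x ^ 2) =O[cocompact ℝ] fun x : ℝ => |x| ^ (2 : ℝ) := by
    refine IsBigO.of_bound (|u| + |v|) (hone.mono fun x hx => ?_)
    have hx2 : (1 : ℝ) ≤ x ^ 2 := by simpa using one_le_pow₀ hx (n := 2)
    simp only [rpow_two, sq_abs, norm_eq_abs, abs_of_nonneg (sq_nonneg x)]
    calc |u + v * x ^ 2| ≤ |u| + |v| * x ^ 2 := by
          rw [← abs_of_nonneg (sq_nonneg x), ← abs_mul, abs_of_nonneg (sq_nonneg x)]
          exact abs_add_le _ _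
      _ ≤ (|u| + |v|) * x ^ 2 := by nlinarith [abs_nonneg u]
  have hexp : (fun x : ℝ => exp (-π * a * x ^ 2)) =O[cocompact ℝ] fun x : ℝ => |x| ^ (-4 : ℝ) := by
    have h := (isLittleO_exp_neg_mul_sq_cocompact (a := ((π * a : ℝ) : ℂ))
      (by rw [Complex.ofReal_re]; positivity) (-4)).isBigO.norm_left
    refine h.congr_left fun x => ?_
    rw [Complex.norm_exp]
    congr 1
    norm_cast
    ring
  refine (hpoly.mul hexp).congr' EventuallyEq.rfl (hone.mono fun x hx => ?_)
  dsimp only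
  rw [← rpow_add (by linarith)]
  norm_num

theorem summable_quadratic_mul_gaussian {a : ℝ} (ha : 0 < a) (u v : ℝ) :
    Summable fun n : ℤ => (u + v * (n : ℝ) ^ 2) * exp (-π * a * (n : ℝ) ^ 2) := by
  refine (((summable_pow_mul_gaussian ha 0).mul_left u).add
    ((summable_pow_mul_gaussian ha 2).mul_left v)).congr fun n => ?_
  rw [sq_abs]
  ring

theorem summable_mul_cos {ι : Type*} {F : ι → ℝ} (hF : Summable F) (φ : ι → ℝ) :
    Summable fun i => F i * cos (φ i) := by
  refine Summable.of_norm_bounded hF.abs fun i => ?_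
  rw [norm_mul, norm_eq_abs, norm_eq_abs]
  exact mul_le_of_le_one_right (abs_nonneg _) (abs_cos_le_one _)

theorem re_ofReal_mul_fourier (c t : ℝ) (n : ℤ) :
    ((c : ℂ) * fourier n (t : UnitAddCircle)).re = c * cos (2 * π * n * t) := by
  have hexponent : (2 * (π : ℂ) * Complex.I * n * t / (1 : ℝ)) =
      ((2 * π * n * t : ℝ) : ℂ) * Complex.I := by
    push_cast
    ring
  rw [fourier_coe_apply, Complex.re_ofReal_mul, hexponent, Complex.exp_ofReal_mul_I_re]

theorem tsum_add_intCast_eq_tsum_mul_cos {f g : ℝ → ℝ} (hf : Continuous f)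
    (hdecay : f =O[cocompact ℝ] fun x : ℝ => |x| ^ (-2 : ℝ))
    (hfourier : (𝓕 fun x : ℝ => (f x : ℂ)) = fun x : ℝ => (g x : ℂ))
    (hg : Summable fun n : ℤ => g n) (t : ℝ) :
    ∑' n : ℤ, f (t + n) = ∑' n : ℤ, g n * cos (2 * π * n * t) := by
  have hpoisson := Real.tsum_eq_tsum_fourier_of_rpow_decay_of_summable
    (f := fun x : ℝ => (f x : ℂ)) (by fun_prop) one_lt_two
    ((Complex.isTheta_ofReal f (cocompact ℝ)).isBigO.trans hdecay)
    (by simpa only [hfourier] using Complex.summable_ofReal.2 hg) t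
  rw [hfourier] at hpoisson
  have hs : Summable fun n : ℤ => (g n : ℂ) * fourier n (t : UnitAddCircle) := by
    refine Summable.of_norm_bounded hg.abs fun n => ?_
    rw [norm_mul, Complex.norm_real, norm_eq_abs]
    exact mul_le_of_le_one_right (abs_nonneg _)
      ((ContinuousMap.norm_coe_le_norm _ _).trans (fourier_norm n).le)
  have hre := congrArg Complex.re hpoisson
  rw [← Complex.ofReal_tsum, Complex.ofReal_re, Complex.re_tsum hs] at hre
  simpa only [re_ofReal_mul_fourier] using hre

theorem tsum_quadratic_mul_gaussian {a : ℝ} (ha : 0 < a) (u v t : ℝ) :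
    ∑' n : ℤ, (u + v * (t + n) ^ 2) * exp (-π * a * (t + n) ^ 2) =
      ∑' n : ℤ, (√a)⁻¹ * (u + v * (1 / (2 * π * a) - (n : ℝ) ^ 2 / a ^ 2)) *
        exp (-π / a * (n : ℝ) ^ 2) * cos (2 * π * n * t) := by
  refine tsum_add_intCast_eq_tsum_mul_cos (by fun_prop) (isBigO_quadratic_mul_gaussian ha u v)
    (fourier_quadratic_mul_gaussian ha u v) ?_ t
  refine ((summable_quadratic_mul_gaussian (inv_pos.2 ha) (u + v * (1 / (2 * π * a)))
    (-(v / a ^ 2))).mul_left (√a)⁻¹).congr fun n => ?_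
  rw [← div_eq_mul_inv]
  ring

/-! ### The Fourier expansion of the lattice sum -/

/-- The squared length `|mz + n|² / Im z` of the vector of coordinates `(m, n)` in the unit-density
lattice attached to `z`. -/
noncomputable def latticeNormSq (z : ℍ) (p : ℤ × ℤ) : ℝ :=
  ((p.1 * z.re + p.2) ^ 2 + (p.1 * z.im) ^ 2) / z.im

theorem norm_sq_div_im_eq_latticeNormSq (z : ℍ) (p : ℤ × ℤ) :
    ‖(p.1 : ℂ) * (z : ℂ) + (p.2 : ℂ)‖ ^ 2 / z.im = latticeNormSq z p := by
  rw [latticeNormSq, ← Complex.normSq_eq_norm_sq, Complex.normSq_apply]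
  congr 1
  simp only [Complex.add_re, Complex.mul_re, Complex.intCast_re, UpperHalfPlane.coe_re,
    Complex.intCast_im, UpperHalfPlane.coe_im, zero_mul, sub_zero, Complex.add_im, Complex.mul_im,
    add_zero]
  ring

theorem latticeNormSq_nonneg (z : ℍ) (p : ℤ × ℤ) : 0 ≤ latticeNormSq z p := by
  have := z.im_pos
  rw [latticeNormSq]
  positivity

theorem latticeM_eq_tsum (α : ℝ) (z : ℍ) :
    latticeM α z = ∑' p : ℤ × ℤ, latticeNormSq z p * exp (-π * α * latticeNormSq z p) := by
  simp only [latticeM, norm_sq_div_im_eq_latticeNormSq]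

theorem summable_latticeNormSq_mul_exp {α : ℝ} (hα : 0 < α) (z : ℍ) :
    Summable fun p : ℤ × ℤ => latticeNormSq z p * exp (-π * α * latticeNormSq z p) := by
  simpa only [norm_sq_div_im_eq_latticeNormSq] using summable_latticeM hα z

/-- The Fourier coefficient of index `(m, k)` of `x ↦ α² M(α, x + iy) / √X`, where `X = αy` and
`Z = y / α`. -/
noncomputable def fourierCoeffM (X Z m k : ℝ) : ℝ :=
  (1 / (2 * π) + X * m ^ 2 - Z * k ^ 2) * exp (-π * (X * m ^ 2 + Z * k ^ 2))

theorem summable_fourierCoeffM {X Z : ℝ} (hX : 0 < X) (hZ : 0 < Z) :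
    Summable fun p : ℤ × ℤ => fourierCoeffM X Z p.1 p.2 := by
  have hprod (i j : ℕ) := (summable_pow_mul_gaussian hX i).mul_of_nonneg
    (summable_pow_mul_gaussian hZ j) (fun n => by positivity) (fun n => by positivity)
  refine ((((hprod 0 0).mul_left (1 / (2 * π))).add ((hprod 2 0).mul_left X)).sub
    ((hprod 0 2).mul_left Z)).congr fun p => ?_
  rw [fourierCoeffM, mul_add (-π), exp_add]
  simp only [sq_abs, pow_zero]
  ring_nf

/-- Poisson summation along the row `m` of the lattice, where
`|mz + n|² / y = ((mx + n)² + (my)²) / y`. -/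
theorem sq_mul_tsum_row {α : ℝ} (hα : 0 < α) (z : ℍ) (m : ℤ) :
    α ^ 2 * ∑' n : ℤ, latticeNormSq z (m, n) * exp (-π * α * latticeNormSq z (m, n)) =
      √(α * z.im) * ∑' k : ℤ, fourierCoeffM (α * z.im) (z.im / α) m k *
        cos (2 * π * m * k * z.re) := by
  obtain ⟨hy, hα0, hpi⟩ := (⟨z.im_pos, hα.ne', pi_ne_zero⟩ : 0 < z.im ∧ α ≠ 0 ∧ π ≠ 0)
  have hsqrt : (√(α / z.im))⁻¹ = √(α * z.im) / α := by
    rw [← sqrt_inv, inv_div, ← sqrt_sq hα.le, ← sqrt_div' _ (by positivity), sqrt_sq hα.le]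
    congr 1
    field_simp
  have hterm (n : ℤ) : latticeNormSq z (m, n) * exp (-π * α * latticeNormSq z (m, n)) =
      exp (-π * (α * z.im * m ^ 2)) * ((m ^ 2 * z.im + 1 / z.im * (m * z.re + n) ^ 2) *
        exp (-π * (α / z.im) * (m * z.re + n) ^ 2)) := by
    rw [mul_left_comm, ← exp_add, latticeNormSq]
    congr 2 <;> field_simp <;> ring
  have hcoeff (k : ℤ) : α ^ 2 * (exp (-π * (α * z.im * m ^ 2)) *
      ((√(α / z.im))⁻¹ * (m ^ 2 * z.im + 1 / z.im *
        (1 / (2 * π * (α / z.im)) - (k : ℝ) ^ 2 / (α / z.im) ^ 2)) *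
          exp (-π / (α / z.im) * (k : ℝ) ^ 2))) =
      √(α * z.im) * fourierCoeffM (α * z.im) (z.im / α) m k := by
    have hexp : exp (-π * (α * z.im * m ^ 2 + z.im / α * k ^ 2)) =
        exp (-π * (α * z.im * m ^ 2)) * exp (-π / (α / z.im) * (k : ℝ) ^ 2) := by
      rw [← exp_add]
      congr 1
      field_simp
      ring
    rw [fourierCoeffM, hexp, hsqrt]
    field_simp
    ring
  simp only [hterm, tsum_mul_left, tsum_quadratic_mul_gaussian (div_pos hα hy)]
  rw [← tsum_mul_left, ← tsum_mul_left, ← tsum_mul_left]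
  refine tsum_congr fun k => ?_
  rw [← mul_assoc (√(α * z.im)), ← hcoeff,
    show 2 * π * m * k * z.re = 2 * π * k * (m * z.re) by ring]
  ring

/-- The real part `∑ₘₖ c(m, k) cos (2π m k x)` of the double Fourier series with coefficients
`c = fourierCoeffM X Z`. -/
noncomputable def fourierSumM (X Z x : ℝ) : ℝ :=
  ∑' p : ℤ × ℤ, fourierCoeffM X Z p.1 p.2 * cos (2 * π * p.1 * p.2 * x)

theorem hasSum_fourierSumM {X Z : ℝ} (hX : 0 < X) (hZ : 0 < Z) (x : ℝ) :
    HasSum (fun p : ℤ × ℤ => fourierCoeffM X Z p.1 p.2 * cos (2 * π * p.1 * p.2 * x))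
      (fourierSumM X Z x) :=
  (summable_mul_cos (summable_fourierCoeffM hX hZ) _).hasSum

theorem sq_mul_latticeM {α : ℝ} (hα : 0 < α) (z : ℍ) :
    α ^ 2 * latticeM α z = √(α * z.im) * fourierSumM (α * z.im) (z.im / α) z.re := by
  have hsum := hasSum_fourierSumM (mul_pos hα z.im_pos) (div_pos z.im_pos hα) z.re
  rw [latticeM_eq_tsum, (summable_latticeNormSq_mul_exp hα z).tsum_prod, fourierSumM,
    hsum.summable.tsum_prod, ← tsum_mul_left, ← tsum_mul_left]
  exact tsum_congr fun m => sq_mul_tsum_row hα z m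

/-! ### Reduction to the closed half fundamental domain -/

section ModularInvariance

open scoped MatrixGroups Modular

/-- The bijection `(m, n) ↦ (m, n) g` of `ℤ²`, for `g ∈ SL(2, ℤ)`. -/
def rowMulEquiv (g : SL(2, ℤ)) : ℤ × ℤ ≃ ℤ × ℤ where
  toFun p := (p.1 * g 0 0 + p.2 * g 1 0, p.1 * g 0 1 + p.2 * g 1 1)
  invFun p := (p.1 * g 1 1 - p.2 * g 1 0, -p.1 * g 0 1 + p.2 * g 0 0)
  left_inv p := by
    have hdet : g 0 0 * g 1 1 - g 0 1 * g 1 0 = 1 := (Matrix.det_fin_two g.1).symm.trans g.2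
    ext
    · linear_combination p.1 * hdet
    · linear_combination p.2 * hdet
  right_inv p := by
    have hdet : g 0 0 * g 1 1 - g 0 1 * g 1 0 = 1 := (Matrix.det_fin_two g.1).symm.trans g.2
    ext
    · linear_combination p.1 * hdet
    · linear_combination p.2 * hdet

theorem latticeNormSq_smul (g : SL(2, ℤ)) (z : ℍ) (p : ℤ × ℤ) :
    latticeNormSq (g • z) p = latticeNormSq z (rowMulEquiv g p) := by
  have hdenom : UpperHalfPlane.denom g z = (g 1 0 : ℂ) * z + g 1 1 := by
    simp [UpperHalfPlane.denom]
  have hd : (g 1 0 : ℂ) * z + g 1 1 ≠ 0 := hdenom ▸ UpperHalfPlane.denom_ne_zero _ z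
  have him : (g • z).im = z.im / ‖(g 1 0 : ℂ) * z + g 1 1‖ ^ 2 := by
    rw [ModularGroup.im_smul_eq_div_normSq, Complex.normSq_eq_norm_sq, hdenom]
  have hvec : (p.1 : ℂ) * ((g • z : ℍ) : ℂ) + (p.2 : ℂ) =
      (((rowMulEquiv g p).1 : ℂ) * (z : ℂ) + ((rowMulEquiv g p).2 : ℂ)) /
        ((g 1 0 : ℂ) * z + g 1 1) := by
    rw [UpperHalfPlane.coe_specialLinearGroup_apply]
    simp only [rowMulEquiv, Equiv.coe_fn_mk, algebraMap_int_eq, eq_intCast]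
    push_cast
    rw [eq_div_iff hd, add_mul, mul_assoc, div_mul_cancel₀ _ hd]
    ring
  rw [← norm_sq_div_im_eq_latticeNormSq, ← norm_sq_div_im_eq_latticeNormSq, hvec, him, norm_div,
    div_pow]
  exact div_div_div_cancel_right₀ (pow_ne_zero 2 (norm_ne_zero_iff.2 hd)) _ _

theorem latticeM_smul (α : ℝ) (g : SL(2, ℤ)) (z : ℍ) : latticeM α (g • z) = latticeM α z := by
  simp only [latticeM_eq_tsum, latticeNormSq_smul]
  exact (rowMulEquiv g).tsum_eq fun p => latticeNormSq z p * exp (-π * α * latticeNormSq z p)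

theorem latticeM_eq_of_re_eq_neg (α : ℝ) {z w : ℍ} (hre : w.re = -z.re) (him : w.im = z.im) :
    latticeM α w = latticeM α z := by
  rw [latticeM_eq_tsum, latticeM_eq_tsum,
    ← ((Equiv.neg ℤ).prodCongr (Equiv.refl ℤ)).tsum_eq fun p =>
      latticeNormSq z p * exp (-π * α * latticeNormSq z p)]
  refine tsum_congr fun p => ?_
  simp [latticeNormSq, hre, him]

/-- The closed right half `{z ∈ ℍ : 0 ≤ Re z ≤ 1/2, |z| ≥ 1}` of the fundamental domain, described
by inequalities; it is contained in the closure of `halfFundamentalDomain`. -/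
def closedHalfDomain : Set ℍ :=
  {z | 0 ≤ z.re ∧ z.re ≤ 1 / 2 ∧ 1 ≤ z.re ^ 2 + z.im ^ 2}

theorem exists_mem_closedHalfDomain_latticeM_eq (α : ℝ) (z : ℍ) :
    ∃ w ∈ closedHalfDomain, latticeM α w = latticeM α z := by
  obtain ⟨g, hnorm, hre⟩ := ModularGroup.exists_smul_mem_fd z
  rw [Complex.normSq_apply, UpperHalfPlane.coe_re, UpperHalfPlane.coe_im, ← sq, ← sq] at hnorm
  rcases le_total 0 (g • z).re with h | h
  · exact ⟨g • z, ⟨h, (le_abs_self _).trans hre, hnorm⟩, latticeM_smul α g z⟩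
  · let w : ℍ := ⟨⟨-(g • z).re, (g • z).im⟩, (g • z).im_pos⟩
    have hw : w.re = -(g • z).re := rfl
    refine ⟨w, ⟨?_, ?_, ?_⟩, (latticeM_eq_of_re_eq_neg α hw rfl).trans (latticeM_smul α g z)⟩
    · rwa [hw, neg_nonneg]
    · exact (neg_le_abs _).trans hre
    · rwa [hw, neg_sq]

theorem closedHalfDomain_subset_fd : closedHalfDomain ⊆ 𝒟 := by
  rintro z ⟨h0, h1, h2⟩
  refine ⟨?_, abs_le.2 ⟨by linarith, h1⟩⟩
  rwa [Complex.normSq_apply, UpperHalfPlane.coe_re, UpperHalfPlane.coe_im, ← sq, ← sq]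

end ModularInvariance

theorem half_lt_im_of_mem_closedHalfDomain {z : ℍ} (hz : z ∈ closedHalfDomain) : 1 / 2 < z.im := by
  obtain ⟨h0, h1, h2⟩ := hz
  nlinarith [z.im_pos]

theorem closedHalfDomain_subset_closure : closedHalfDomain ⊆ closure halfFundamentalDomain := by
  intro z hz
  have hy := half_lt_im_of_mem_closedHalfDomain hz
  obtain ⟨h0, h1, h2⟩ := hz
  -- Moving up, and towards the line `Re w = 1/4`, enters the open domain immediately.
  let f : ℝ → ℂ := fun t => (z.re + t * (1 / 4 - z.re) : ℝ) + (z.im + t : ℝ) * Complex.I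
  have hfre (t : ℝ) : (f t).re = z.re + t * (1 / 4 - z.re) := by simp [f]
  have hfim (t : ℝ) : (f t).im = z.im + t := by simp [f]
  have hlim : Tendsto f (𝓝[>] 0) (𝓝 (z : ℂ)) := by
    have hf : Continuous f := by fun_prop
    have hf0 : f 0 = z := Complex.ext (by simp [hfre]) (by simp [hfim])
    exact hf0 ▸ hf.continuousAt.tendsto.mono_left nhdsWithin_le_nhds
  rw [UpperHalfPlane.isOpenEmbedding_coe.isInducing.closure_eq_preimage_closure_image]
  refine mem_closure_of_tendsto hlim ?_
  filter_upwards [Ioo_mem_nhdsGT (zero_lt_one (α := ℝ))] with t ⟨ht0, ht1⟩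
  refine ⟨⟨f t, by rw [hfim]; linarith⟩, ⟨?_, ?_, ?_⟩, rfl⟩
  · change 1 < ‖f t‖
    rw [← one_lt_sq_iff₀ (norm_nonneg _), ← Complex.normSq_eq_norm_sq, Complex.normSq_apply, hfre,
      hfim]
    have hslope : 0 < z.im + z.re * (1 / 4 - z.re) := by nlinarith
    nlinarith [sq_nonneg (t * (1 / 4 - z.re)), mul_pos ht0 hslope, sq_nonneg t]
  · change 0 < (f t).re
    rw [hfre]
    nlinarith
  · change (f t).re < 1 / 2
    rw [hfre]
    nlinarith

theorem mem_gammaA_iff {z : ℍ} : z ∈ gammaA ↔ z.re = 0 ∧ 1 ≤ z.im := by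
  constructor
  · rintro ⟨y, hy, hz⟩
    rw [← UpperHalfPlane.coe_re, ← UpperHalfPlane.coe_im, hz]
    simpa using hy
  · rintro ⟨hre, him⟩
    exact ⟨z.im, him, Complex.ext (by simp [hre]) (by simp)⟩

theorem mem_gammaB_iff {z : ℍ} :
    z ∈ gammaB ↔ 0 ≤ z.re ∧ z.re ≤ 1 / 2 ∧ z.re ^ 2 + z.im ^ 2 = 1 := by
  have hpi := pi_pos
  constructor
  · rintro ⟨t, ⟨ht1, ht2⟩, hz⟩
    rw [mul_comm] at hz
    rw [← UpperHalfPlane.coe_re, ← UpperHalfPlane.coe_im, hz, Complex.exp_ofReal_mul_I_re,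
      Complex.exp_ofReal_mul_I_im, ← cos_pi_div_three]
    exact ⟨cos_nonneg_of_mem_Icc ⟨by linarith, ht2⟩,
      cos_le_cos_of_nonneg_of_le_pi (by positivity) (by linarith) ht1, cos_sq_add_sin_sq t⟩
  · rintro ⟨h0, h1, h2⟩
    have hsin : sin (arccos z.re) = z.im := by
      rw [sin_arccos, ← h2, add_sub_cancel_left, sqrt_sq z.im_pos.le]
    have hcos : cos (arccos z.re) = z.re := cos_arccos (by linarith) (by linarith)
    have hthird : π / 3 = arccos (1 / 2) := by
      rw [← cos_pi_div_three, arccos_cos (by positivity) (by linarith)]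
    refine ⟨arccos z.re, ⟨hthird ▸ arccos_le_arccos h1, arccos_le_pi_div_two.2 h0⟩, ?_⟩
    rw [mul_comm]
    apply Complex.ext
    · rw [Complex.exp_ofReal_mul_I_re, hcos, UpperHalfPlane.coe_re]
    · rw [Complex.exp_ofReal_mul_I_im, hsin, UpperHalfPlane.coe_im]

theorem gamma_subset_closedHalfDomain : gammaA ∪ gammaB ⊆ closedHalfDomain := by
  rintro z (hz | hz)
  · obtain ⟨hre, him⟩ := mem_gammaA_iff.1 hz
    refine ⟨hre.ge, ?_, ?_⟩ <;> rw [hre]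
    · norm_num
    · nlinarith
  · obtain ⟨h0, h1, h2⟩ := mem_gammaB_iff.1 hz
    exact ⟨h0, h1, h2.ge⟩

/-! ### Existence of minimizers -/

theorem latticeM_nonneg (α : ℝ) (z : ℍ) : 0 ≤ latticeM α z := by
  rw [latticeM_eq_tsum]
  exact tsum_nonneg fun p => mul_nonneg (latticeNormSq_nonneg z p) (exp_pos _).le

theorem sum_le_latticeM {α : ℝ} (hα : 0 < α) (z : ℍ) (s : Finset (ℤ × ℤ)) :
    ∑ p ∈ s, latticeNormSq z p * exp (-π * α * latticeNormSq z p) ≤ latticeM α z := by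
  rw [latticeM_eq_tsum]
  exact (summable_latticeNormSq_mul_exp hα z).sum_le_tsum s
    fun p _ => mul_nonneg (latticeNormSq_nonneg z p) (exp_pos _).le

theorem lowerSemicontinuous_ofReal_latticeM {α : ℝ} (hα : 0 < α) :
    LowerSemicontinuous fun z : ℍ => ENNReal.ofReal (latticeM α z) := by
  have htsum (z : ℍ) : ENNReal.ofReal (latticeM α z) = ∑' p : ℤ × ℤ,
      ENNReal.ofReal (latticeNormSq z p * exp (-π * α * latticeNormSq z p)) := by
    rw [latticeM_eq_tsum]
    exact ENNReal.ofReal_tsum_of_nonneg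
      (fun p => mul_nonneg (latticeNormSq_nonneg z p) (exp_pos _).le)
      (summable_latticeNormSq_mul_exp hα z)
  have hcont (p : ℤ × ℤ) : Continuous fun z : ℍ => latticeNormSq z p :=
    Continuous.div (by fun_prop) (by fun_prop) fun z => z.im_pos.ne'
  simp only [htsum]
  exact lowerSemicontinuous_tsum fun p =>
    (ENNReal.continuous_ofReal.comp (by fun_prop)).lowerSemicontinuous

/-- The vectors `(0, n)` with `√(Im z) < n ≤ 4 √(Im z)` have squared length between `1` and `16`. -/
theorem sqrt_im_mul_exp_le_latticeM {α : ℝ} (hα : 0 < α) (z : ℍ) (hz : 1 ≤ z.im) :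
    √z.im * exp (-π * α * 16) ≤ latticeM α z := by
  have hsqrt : 1 ≤ √z.im := one_le_sqrt.2 hz
  have hsq := sq_sqrt z.im_pos.le
  set N := ⌈√z.im⌉₊
  have hN_le : √z.im ≤ N := Nat.le_ceil _
  have hN_lt : (N : ℝ) < √z.im + 1 := Nat.ceil_lt_add_one (sqrt_nonneg _)
  have hnorm (n : ℕ) (hn : n ∈ Finset.Ioc N (2 * N)) : 1 ≤ latticeNormSq z (0, n) ∧
      latticeNormSq z (0, n) ≤ 16 := by
    rw [Finset.mem_Ioc] at hn
    have h1 : (N : ℝ) < n := mod_cast hn.1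
    have h2 : (n : ℝ) ≤ 2 * N := mod_cast hn.2
    have heq : latticeNormSq z (0, n) = (n : ℝ) ^ 2 / z.im := by simp [latticeNormSq]
    rw [heq, le_div_iff₀ z.im_pos, div_le_iff₀ z.im_pos, ← hsq]
    constructor <;> nlinarith
  let ι : ℕ ↪ ℤ × ℤ := ⟨fun n => (0, (n : ℤ)), fun a b hab => by simpa using hab⟩
  calc √z.im * exp (-π * α * 16) ≤ N * exp (-π * α * 16) := by gcongr
    _ = ∑ n ∈ Finset.Ioc N (2 * N), 1 * exp (-π * α * 16) := by
      rw [Finset.sum_const, Nat.card_Ioc, nsmul_eq_mul, one_mul, two_mul, Nat.add_sub_cancel]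
    _ ≤ ∑ n ∈ Finset.Ioc N (2 * N),
        latticeNormSq z (0, n) * exp (-π * α * latticeNormSq z (0, n)) := by
      refine Finset.sum_le_sum fun n hn => mul_le_mul (hnorm n hn).1 (exp_le_exp.2 ?_)
        (exp_pos _).le (latticeNormSq_nonneg z _)
      exact mul_le_mul_of_nonpos_left (hnorm n hn).2 (by nlinarith [pi_pos])
    _ = ∑ p ∈ (Finset.Ioc N (2 * N)).map ι,
        latticeNormSq z p * exp (-π * α * latticeNormSq z p) := by
      rw [Finset.sum_map]
      rfl
    _ ≤ latticeM α z := sum_le_latticeM hα z _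

theorem exists_lt_latticeM_of_lt_im {α : ℝ} (hα : 0 < α) (C : ℝ) :
    ∃ Y : ℝ, 1 ≤ Y ∧ ∀ z : ℍ, Y < z.im → C < latticeM α z := by
  have hE : 0 < exp (-π * α * 16) := exp_pos _
  refine ⟨max 1 ((C / exp (-π * α * 16)) ^ 2), le_max_left _ _, fun z hz => ?_⟩
  rw [max_lt_iff] at hz
  exact ((div_lt_iff₀ hE).1 (lt_sqrt_of_sq_lt hz.2)).trans_le
    (sqrt_im_mul_exp_le_latticeM hα z hz.1.le)

theorem exists_forall_latticeM_le {α : ℝ} (hα : 0 < α) :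
    ∃ w : ℍ, ∀ z : ℍ, latticeM α w ≤ latticeM α z := by
  obtain ⟨Y, hY1, hY⟩ := exists_lt_latticeM_of_lt_im hα (latticeM α UpperHalfPlane.I)
  have hI : UpperHalfPlane.I ∈ ModularGroup.truncatedFundamentalDomain Y :=
    ⟨closedHalfDomain_subset_fd (by norm_num [closedHalfDomain]), by simpa using hY1⟩
  obtain ⟨w, -, hw⟩ := LowerSemicontinuousOn.exists_isMinOn ⟨_, hI⟩
    (ModularGroup.isCompact_truncatedFundamentalDomain Y)
    ((lowerSemicontinuous_ofReal_latticeM hα).lowerSemicontinuousOn _)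
  have hmin {z : ℍ} (hz : z ∈ ModularGroup.truncatedFundamentalDomain Y) :
      latticeM α w ≤ latticeM α z :=
    (ENNReal.ofReal_le_ofReal_iff (latticeM_nonneg α z)).1 (hw hz)
  refine ⟨w, fun z => ?_⟩
  obtain ⟨v, hv, hvz⟩ := exists_mem_closedHalfDomain_latticeM_eq α z
  rw [← hvz]
  rcases le_or_gt v.im Y with h | h
  · exact hmin ⟨closedHalfDomain_subset_fd hv, h⟩
  · exact (hmin hI).trans (hY v h).le

theorem exists_isLeast_of_forall_closedHalfDomain {α : ℝ} (hα : 0 < α)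
    (hdom : ∀ z ∈ closedHalfDomain, ∃ w ∈ gammaA ∪ gammaB, latticeM α w ≤ latticeM α z) :
    ∃ μ : ℝ,
      IsLeast (range (latticeM α)) μ ∧
      IsLeast (latticeM α '' closure halfFundamentalDomain) μ ∧
      IsLeast (latticeM α '' (gammaA ∪ gammaB)) μ := by
  obtain ⟨w, hw⟩ := exists_forall_latticeM_le hα
  obtain ⟨v, hv, hvw⟩ := exists_mem_closedHalfDomain_latticeM_eq α w
  obtain ⟨u, hu, huv⟩ := hdom v hv
  have hmin (z : ℍ) : latticeM α u ≤ latticeM α z := huv.trans (hvw.trans_le (hw z))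
  have hu' : u ∈ closure halfFundamentalDomain :=
    closedHalfDomain_subset_closure (gamma_subset_closedHalfDomain hu)
  exact ⟨latticeM α u, ⟨mem_range_self u, forall_mem_range.2 hmin⟩,
    ⟨mem_image_of_mem _ hu', forall_mem_image.2 fun z _ => hmin z⟩,
    ⟨mem_image_of_mem _ hu, forall_mem_image.2 fun z _ => hmin z⟩⟩

/-! ### Numerical bounds for the exponential -/

theorem exp_sub_natCast_le (n : ℕ) {x : ℝ} (h0 : 0 ≤ x) (h1 : x ≤ 1) :
    exp (x - n) ≤ (1 + x + x ^ 2 / 2 + x ^ 3 / 6 + x ^ 4 / 24 + x ^ 5 / 120 + x ^ 6 / 720 +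
      x ^ 7 / 4410) / 2.7182818283 ^ n := by
  have htaylor := exp_bound' h0 h1 (n := 7) (by norm_num)
  have he : (2.7182818283 : ℝ) ^ n ≤ exp n := by
    rw [← exp_one_pow]
    gcongr
    exact exp_one_gt_d9.le
  rw [exp_sub]
  gcongr
  refine htaylor.trans_eq ?_
  simp only [Finset.sum_range_succ, Finset.sum_range_zero, Nat.factorial]
  norm_num
  ring

theorem le_exp_sub_natCast (n : ℕ) {x : ℝ} (h0 : 0 ≤ x) :
    (1 + x + x ^ 2 / 2 + x ^ 3 / 6 + x ^ 4 / 24 + x ^ 5 / 120 + x ^ 6 / 720) /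
      2.7182818286 ^ n ≤ exp (x - n) := by
  have htaylor := sum_le_exp_of_nonneg h0 7
  have he : exp n ≤ (2.7182818286 : ℝ) ^ n := by
    rw [← exp_one_pow]
    gcongr
    exact exp_one_lt_d9.le
  rw [exp_sub]
  gcongr
  refine Eq.trans_le ?_ htaylor
  simp only [Finset.sum_range_succ, Finset.sum_range_zero, Nat.factorial]
  norm_num

theorem exp_neg_pi_le : exp (-π) ≤ 0.0434 :=
  calc exp (-π) ≤ exp (0.86 - (4 : ℕ)) := exp_le_exp.2 (by norm_num; linarith [pi_gt_d2])
    _ ≤ 0.0434 := (exp_sub_natCast_le 4 (by norm_num) (by norm_num)).trans (by norm_num)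

theorem exp_neg_three_pi_quarter_le : exp (-(3 * π * (1 / 4))) ≤ 0.0949 :=
  calc exp (-(3 * π * (1 / 4))) ≤ exp (0.64381 - (3 : ℕ)) :=
        exp_le_exp.2 (by norm_num; linarith [pi_gt_d6])
    _ ≤ 0.0949 := (exp_sub_natCast_le 3 (by norm_num) (by norm_num)).trans (by norm_num)

theorem exp_neg_five_pi_quarter_le : exp (-(5 * π * (1 / 4))) ≤ 0.0236 :=
  calc exp (-(5 * π * (1 / 4))) ≤ exp (0.25 - (4 : ℕ)) :=
        exp_le_exp.2 (by norm_num; linarith [pi_gt_three])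
    _ ≤ 0.0236 := (exp_sub_natCast_le 4 (by norm_num) (by norm_num)).trans (by norm_num)

theorem one_div_two_pi_mem_Icc : 1 / (2 * π) ∈ Icc 0.15915 0.159156 := by
  constructor
  · rw [le_div_iff₀ (by positivity)]
    linarith [pi_lt_d6]
  · rw [div_le_iff₀ (by positivity)]
    linarith [pi_gt_d6]

/-- The constant is `e⁻⁶`, rounded up. -/
theorem mul_exp_neg_pi_mul_le {u : ℝ} (hu : 3 ≤ u) : u * exp (-π * u) ≤ 0.0025 :=
  calc u * exp (-π * u) ≤ exp u * exp (-π * u) := by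
        gcongr
        linarith [add_one_le_exp u]
    _ = exp (u - π * u) := by rw [← exp_add]; ring_nf
    _ ≤ exp (0 - (6 : ℕ)) := by
        rw [exp_le_exp]
        norm_num
        nlinarith [pi_gt_three]
    _ ≤ 0.0025 := (exp_sub_natCast_le 6 le_rfl zero_le_one).trans (by norm_num)

/-! ### One-dimensional Gaussian moments -/

/-- The moment `∑ nʲ exp (-π a n²)` of the discrete Gaussian; `j = 0` is the theta constant
`θ₃(i a)`, and `j = 2` is `-1/π` times its derivative in `a`. -/
noncomputable def gaussMoment (j : ℕ) (a : ℝ) : ℝ :=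
  ∑' n : ℤ, (n : ℝ) ^ j * exp (-π * a * (n : ℝ) ^ 2)

theorem summable_norm_gaussMoment {a : ℝ} (ha : 0 < a) (j : ℕ) :
    Summable fun n : ℤ => ‖(n : ℝ) ^ j * exp (-π * a * (n : ℝ) ^ 2)‖ := by
  simpa only [norm_mul, norm_pow, norm_eq_abs, abs_exp] using summable_pow_mul_gaussian ha j

theorem hasSum_gaussMoment {a : ℝ} (ha : 0 < a) (j : ℕ) :
    HasSum (fun n : ℤ => (n : ℝ) ^ j * exp (-π * a * (n : ℝ) ^ 2)) (gaussMoment j a) :=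
  (summable_norm_gaussMoment ha j).of_norm.hasSum

theorem gaussMoment_nonneg {j : ℕ} (hj : Even j) (a : ℝ) : 0 ≤ gaussMoment j a :=
  tsum_nonneg fun _ => mul_nonneg (hj.pow_nonneg _) (exp_nonneg _)

theorem one_le_gaussMoment_zero {a : ℝ} (ha : 0 < a) : 1 ≤ gaussMoment 0 a := by
  simpa [gaussMoment] using (hasSum_gaussMoment ha 0).summable.le_tsum 0 fun _ _ => by positivity

theorem hasSum_prod_gaussMoment {X Z : ℝ} (hX : 0 < X) (hZ : 0 < Z) (i j : ℕ) :
    HasSum (fun p : ℤ × ℤ =>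
        (p.1 : ℝ) ^ i * (p.2 : ℝ) ^ j * exp (-π * (X * (p.1 : ℝ) ^ 2 + Z * (p.2 : ℝ) ^ 2)))
      (gaussMoment i X * gaussMoment j Z) := by
  have hsum := (summable_norm_gaussMoment hX i).mul_norm (summable_norm_gaussMoment hZ j)
  rw [gaussMoment, gaussMoment, tsum_mul_tsum_of_summable_norm (summable_norm_gaussMoment hX i)
    (summable_norm_gaussMoment hZ j)]
  refine hsum.of_norm.hasSum.congr_fun fun p => ?_
  rw [mul_add, exp_add, ← mul_assoc (-π), ← mul_assoc (-π)]
  exact (mul_mul_mul_comm _ _ _ _).symm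

theorem hasSum_quadratic_mul_gaussian_prod {X Z : ℝ} (hX : 0 < X) (hZ : 0 < Z) (u v w : ℝ) :
    HasSum (fun p : ℤ × ℤ => (u + v * (p.1 : ℝ) ^ 2 + w * (p.2 : ℝ) ^ 2) *
        exp (-π * (X * (p.1 : ℝ) ^ 2 + Z * (p.2 : ℝ) ^ 2)))
      (u * (gaussMoment 0 X * gaussMoment 0 Z) + v * (gaussMoment 2 X * gaussMoment 0 Z) +
        w * (gaussMoment 0 X * gaussMoment 2 Z)) := by
  refine ((((hasSum_prod_gaussMoment hX hZ 0 0).mul_left u).add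
    ((hasSum_prod_gaussMoment hX hZ 2 0).mul_left v)).add
    ((hasSum_prod_gaussMoment hX hZ 0 2).mul_left w)).congr_fun fun p => ?_
  ring

theorem sqrt_mul_gaussMoment {a : ℝ} (ha : 0 < a) (u v : ℝ) :
    √a * (u * gaussMoment 0 a + v * (a * gaussMoment 2 a)) =
      (u + v / (2 * π)) * gaussMoment 0 a⁻¹ - v * (a⁻¹ * gaussMoment 2 a⁻¹) := by
  have hdirect := ((hasSum_gaussMoment ha 0).mul_left u).add
    (((hasSum_gaussMoment ha 2).mul_left a).mul_left v)
  have hdual := ((hasSum_gaussMoment (inv_pos.2 ha) 0).mul_left (u + v / (2 * π))).sub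
    (((hasSum_gaussMoment (inv_pos.2 ha) 2).mul_left a⁻¹).mul_left v)
  have hpoisson := tsum_quadratic_mul_gaussian ha u (v * a) 0
  rw [← hdirect.tsum_eq, ← hdual.tsum_eq, ← tsum_mul_left]
  calc ∑' n : ℤ, √a * (u * ((n : ℝ) ^ 0 * exp (-π * a * n ^ 2)) +
        v * (a * ((n : ℝ) ^ 2 * exp (-π * a * n ^ 2))))
      = √a * ∑' n : ℤ, (u + v * a * (0 + (n : ℝ)) ^ 2) * exp (-π * a * (0 + n) ^ 2) := by
        rw [← tsum_mul_left]
        refine tsum_congr fun n => ?_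
        rw [zero_add]
        ring
    _ = _ := by
        rw [hpoisson, ← tsum_mul_left]
        refine tsum_congr fun n => ?_
        rw [mul_zero, cos_zero, div_eq_mul_inv (-π) a]
        field_simp
        ring

theorem exp_neg_mul_succ_sq_le {c : ℝ} (hc : 0 ≤ c) (n : ℕ) :
    exp (-c * ((n : ℝ) + 1) ^ 2) ≤ exp (-c) * (exp (-c) ^ 3) ^ n := by
  rw [← pow_mul, ← exp_nat_mul, ← exp_add, exp_le_exp]
  have hn : (n : ℝ) ≤ (n : ℝ) ^ 2 := by exact_mod_cast Nat.le_self_pow two_ne_zero n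
  push_cast
  nlinarith

/-- Comparison with a geometric series, through `(n + 1)² ≥ 1 + 3 * n` and `(n + 1)ʲ ≤ 2ʲⁿ`. -/
theorem gaussMoment_le {a q : ℝ} (ha : 0 < a) {j : ℕ} (hj : Even j) (hq : exp (-π * a) ≤ q)
    (hq1 : 2 ^ j * q ^ 3 < 1) : gaussMoment j a ≤ 0 ^ j + 2 * (q / (1 - 2 ^ j * q ^ 3)) := by
  have hq0 : 0 < q := (exp_pos _).trans_le hq
  set f : ℤ → ℝ := fun n => (n : ℝ) ^ j * exp (-π * a * (n : ℝ) ^ 2)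
  have hf : Summable f := (hasSum_gaussMoment ha j).summable
  have hfeven : f.Even := fun n => by simp only [f, Int.cast_neg, hj.neg_pow, even_two.neg_pow]
  have hf0 : f 0 = 0 ^ j := by simp [f]
  have hgeom : HasSum (fun n : ℕ => q * (2 ^ j * q ^ 3) ^ n) (q / (1 - 2 ^ j * q ^ 3)) := by
    simpa only [div_eq_mul_inv] using
      (hasSum_geometric_of_lt_one (by positivity) hq1).mul_left q
  have hterm (n : ℕ) : f (n + 1 : ℕ) ≤ q * (2 ^ j * q ^ 3) ^ n := by
    have hpow : ((n : ℝ) + 1) ^ j ≤ (2 ^ j) ^ n := by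
      rw [← pow_mul, mul_comm, pow_mul]
      gcongr
      exact_mod_cast Nat.lt_two_pow_self (n := n)
    have hexp : exp (-π * a * ((n : ℝ) + 1) ^ 2) ≤ q * (q ^ 3) ^ n := by
      rw [neg_mul] at hq ⊢
      exact (exp_neg_mul_succ_sq_le (by positivity) n).trans (by gcongr)
    calc f (n + 1 : ℕ) = ((n : ℝ) + 1) ^ j * exp (-π * a * ((n : ℝ) + 1) ^ 2) := by
          simp only [f]; push_cast; rfl
      _ ≤ (2 ^ j) ^ n * (q * (q ^ 3) ^ n) := by gcongr
      _ = q * (2 ^ j * q ^ 3) ^ n := by rw [mul_pow]; ring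
  have htail : ∑' n : ℕ, f (n + 1 : ℕ) ≤ q / (1 - 2 ^ j * q ^ 3) :=
    (Summable.tsum_le_tsum hterm (hf.comp_injective
      (Nat.cast_injective.comp Nat.succ_injective)) hgeom.summable).trans hgeom.tsum_eq.le
  rw [gaussMoment, tsum_int_eq_zero_add_two_mul_tsum_pnat hfeven hf,
    tsum_pnat_eq_tsum_succ (f := fun n : ℕ => f n), hf0, nsmul_eq_mul,
    Nat.cast_ofNat]
  gcongr

theorem latticeM_I {α : ℝ} (hα : 0 < α) :
    latticeM α UpperHalfPlane.I = 2 * (gaussMoment 0 α * gaussMoment 2 α) := by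
  have hsum := (hasSum_quadratic_mul_gaussian_prod hα hα 0 1 1).tsum_eq
  calc latticeM α UpperHalfPlane.I
      = ∑' p : ℤ × ℤ, (0 + 1 * (p.1 : ℝ) ^ 2 + 1 * (p.2 : ℝ) ^ 2) *
          exp (-π * (α * (p.1 : ℝ) ^ 2 + α * (p.2 : ℝ) ^ 2)) := by
        rw [latticeM_eq_tsum]
        refine tsum_congr fun p => ?_
        simp only [latticeNormSq, UpperHalfPlane.I_re, UpperHalfPlane.I_im]
        ring_nf
    _ = 2 * (gaussMoment 0 α * gaussMoment 2 α) := by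
        rw [hsum]
        ring

theorem gaussMoment_zero_le_of_three_le {u : ℝ} (hu : 3 ≤ u) : gaussMoment 0 u ≤ 1.0051 := by
  have hq : exp (-π * u) ≤ 0.0025 :=
    (le_mul_of_one_le_left (exp_nonneg _) (by linarith)).trans (mul_exp_neg_pi_mul_le hu)
  exact (gaussMoment_le (by linarith) Even.zero hq (by norm_num)).trans (by norm_num)

theorem mul_gaussMoment_two_le_of_three_le {u : ℝ} (hu : 3 ≤ u) :
    u * gaussMoment 2 u ≤ 0.0051 := by
  have hu0 : 0 < u := by linarith
  have hq : exp (-π * u) ≤ 0.0025 / u := (le_div_iff₀' hu0).2 (mul_exp_neg_pi_mul_le hu)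
  have hq3 : 2 ^ 2 * (0.0025 / u) ^ 3 ≤ 0.001 := by
    have hqu : 0.0025 / u ≤ 0.0025 := div_le_self (by norm_num) (by linarith)
    calc 2 ^ 2 * (0.0025 / u) ^ 3 ≤ 2 ^ 2 * 0.0025 ^ 3 := by gcongr
      _ ≤ 0.001 := by norm_num
  calc u * gaussMoment 2 u
      ≤ u * (0 ^ 2 + 2 * (0.0025 / u / (1 - 2 ^ 2 * (0.0025 / u) ^ 3))) := by
        gcongr
        exact gaussMoment_le hu0 even_two hq (by linarith)
    _ ≤ u * (0 ^ 2 + 2 * (0.0025 / u / 0.999)) := by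
        gcongr
        linarith
    _ = 2 * (0.0025 / 0.999) := by
        field_simp
        ring
    _ ≤ 0.0051 := by norm_num

/-! ### Lattices close to the hexagonal one -/

/-- The contribution `q exp (-c q)` to `latticeM` of a lattice vector of squared length `q`, where
`c = π α`. -/
noncomputable def vectorTerm (c q : ℝ) : ℝ := q * exp (-c * q)

/-- The squared length `2/√3` of the shortest vectors of the hexagonal lattice of covolume `1`. -/
noncomputable def hexNormSq : ℝ := 2 / √3

/-- Heron's expression: sixteen times the squared area of a triangle, in terms of the squares of its
sides. -/
def heronForm (q₁ q₂ q₃ : ℝ) : ℝ :=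
  2 * (q₁ * q₂ + q₂ * q₃ + q₃ * q₁) - (q₁ ^ 2 + q₂ ^ 2 + q₃ ^ 2)

theorem three_mul_hexNormSq_sq : 3 * hexNormSq ^ 2 = 4 := by
  rw [hexNormSq, div_pow, sq_sqrt (by norm_num)]
  norm_num

theorem hexNormSq_mem_Icc : hexNormSq ∈ Icc 1.1547 1.154701 := by
  have hpos : 0 < hexNormSq := div_pos two_pos (sqrt_pos.2 three_pos)
  constructor <;> nlinarith [three_mul_hexNormSq_sq]

theorem exp_neg_mul_hexNormSq_pow_three (c : ℝ) :
    exp (-c * hexNormSq) ^ 3 = exp (-c * (3 * hexNormSq)) := by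
  rw [← exp_nat_mul]
  push_cast
  ring_nf

theorem heronForm_latticeNormSq (z : ℍ) (p q : ℤ × ℤ) :
    heronForm (latticeNormSq z p) (latticeNormSq z q) (latticeNormSq z (p - q)) =
      4 * ((p.1 : ℝ) * q.2 - p.2 * q.1) ^ 2 := by
  have hy := z.im_pos.ne'
  simp only [heronForm, latticeNormSq, Prod.fst_sub, Prod.snd_sub, Int.cast_sub]
  field_simp
  ring

theorem heronForm_first_shell (z : ℍ) :
    heronForm (latticeNormSq z (1, 0)) (latticeNormSq z (0, 1)) (latticeNormSq z (1, -1)) = 4 := by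
  simpa using heronForm_latticeNormSq z (1, 0) (0, 1)

theorem heronForm_second_shell (z : ℍ) :
    heronForm (latticeNormSq z (2, -1)) (latticeNormSq z (1, 1)) (latticeNormSq z (1, -2)) =
      36 := by
  have hheron := heronForm_latticeNormSq z (2, -1) (1, 1)
  norm_num at hheron
  exact hheron

theorem second_shell_sum_eq (z : ℍ) :
    latticeNormSq z (2, -1) + latticeNormSq z (1, 1) + latticeNormSq z (1, -2) =
      3 * (latticeNormSq z (1, 0) + latticeNormSq z (0, 1) + latticeNormSq z (1, -1)) := by
  have hy := z.im_pos.ne'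
  simp only [latticeNormSq]
  push_cast
  field_simp
  ring

theorem shells_le_latticeM {α : ℝ} (hα : 0 < α) (z : ℍ) :
    2 * (vectorTerm (π * α) (latticeNormSq z (1, 0)) + vectorTerm (π * α) (latticeNormSq z (0, 1)) +
        vectorTerm (π * α) (latticeNormSq z (1, -1))) +
      2 * (vectorTerm (π * α) (latticeNormSq z (2, -1)) +
        vectorTerm (π * α) (latticeNormSq z (1, 1)) +
        vectorTerm (π * α) (latticeNormSq z (1, -2))) ≤ latticeM α z := by
  have hneg (m n : ℤ) : latticeNormSq z (-m, -n) = latticeNormSq z (m, n) := by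
    simp only [latticeNormSq]
    push_cast
    ring
  refine Eq.trans_le ?_ (sum_le_latticeM hα z {(1, 0), (-1, -0), (0, 1), (-0, -1), (1, -1),
    (-1, - -1), (2, -1), (-2, - -1), (1, 1), (-1, -1), (1, -2), (-1, - -2)})
  iterate 11 rw [Finset.sum_insert (by decide)]
  rw [Finset.sum_singleton]
  simp only [hneg, vectorTerm, neg_mul]
  ring

theorem three_mul_hexNormSq_le_of_heronForm {q₁ q₂ q₃ : ℝ} (hsum : 0 ≤ q₁ + q₂ + q₃)
    (hheron : heronForm q₁ q₂ q₃ = 4) : 3 * hexNormSq ≤ q₁ + q₂ + q₃ := by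
  rw [heronForm] at hheron
  refine (abs_le_of_sq_le_sq' ?_ hsum).2
  linarith [three_mul_hexNormSq_sq, sq_nonneg (q₁ - q₂), sq_nonneg (q₂ - q₃), sq_nonneg (q₃ - q₁)]

theorem hexNormSq_mul_sub_le_sum_sq {q₁ q₂ q₃ : ℝ} (hheron : heronForm q₁ q₂ q₃ = 4) :
    hexNormSq * (q₁ + q₂ + q₃ - 3 * hexNormSq) ≤
      (q₁ - hexNormSq) ^ 2 + (q₂ - hexNormSq) ^ 2 + (q₃ - hexNormSq) ^ 2 := by
  rw [heronForm] at hheron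
  linarith [three_mul_hexNormSq_sq, sq_nonneg (q₁ + q₂ + q₃ - 3 * hexNormSq)]

theorem cubic_le_exp_neg {t : ℝ} (ht : |t| ≤ 1) : 1 - t + t ^ 2 / 2 - t ^ 3 / 6 ≤ exp (-t) := by
  have htaylor := neg_le_of_abs_le (exp_bound (x := -t) (by rwa [abs_neg]) (n := 5) (by norm_num))
  simp only [Finset.sum_range_succ, Finset.sum_range_zero, Nat.factorial] at htaylor
  norm_num at htaylor
  have hpow : |t| ^ 5 ≤ t ^ 4 := by
    rw [← Even.pow_abs (by decide : Even 4) t]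
    exact pow_le_pow_of_le_one (abs_nonneg t) ht (by norm_num)
  nlinarith [sq_nonneg (t ^ 2)]

/-- The coefficient of `d²` is that of the Taylor expansion of `(h + d) exp (-c d)`, diminished by
`0.052` to absorb the terms of higher order. -/
theorem quadratic_le_mul_cubic {c d : ℝ} (hc : 2.868 ≤ c) (hc' : c ≤ 2.8764) (hd : |d| ≤ 0.071) :
    hexNormSq + (1 - c * hexNormSq) * d + (c * (c * hexNormSq / 2 - 1) - 0.052) * d ^ 2 ≤
      (hexNormSq + d) * (1 - c * d + (c * d) ^ 2 / 2 - (c * d) ^ 3 / 6) := by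
  obtain ⟨hh, hh'⟩ := hexNormSq_mem_Icc
  obtain ⟨hd1, hd2⟩ := abs_le.1 hd
  have hs : 3 ≤ c * hexNormSq := by nlinarith
  have hs' : c * hexNormSq ≤ 3.32142 := by nlinarith
  have hc2 : c ^ 2 ≤ 8.27368 := by nlinarith
  have hc3 : c ^ 3 ≤ 23.7985 := by
    calc c ^ 3 ≤ 2.8764 ^ 3 := by gcongr
      _ ≤ 23.7985 := by norm_num
  have hcubic : c ^ 2 * (c * hexNormSq - 3) * d ≤ 2.66 * 0.071 := by
    have hcoeff : c ^ 2 * (c * hexNormSq - 3) ≤ 2.66 := by nlinarith [sq_nonneg c]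
    have hcoeff0 : 0 ≤ c ^ 2 * (c * hexNormSq - 3) := mul_nonneg (sq_nonneg c) (by linarith)
    nlinarith
  have hquartic : c ^ 3 * d ^ 2 ≤ 23.7985 * 0.071 ^ 2 := by
    have hdsq : d ^ 2 ≤ 0.071 ^ 2 := sq_le_sq' hd1 hd2
    gcongr
  have hremainder :
      0 ≤ d ^ 2 * (0.052 - c ^ 2 * (c * hexNormSq - 3) * d / 6 - c ^ 3 * d ^ 2 / 6) :=
    mul_nonneg (sq_nonneg d) (by linarith)
  linear_combination hremainder

theorem quadratic_le_vectorTerm {c q : ℝ} (hc : 2.868 ≤ c) (hc' : c ≤ 2.8764)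
    (hq : |q - hexNormSq| ≤ 0.071) :
    exp (-c * hexNormSq) * (hexNormSq + (1 - c * hexNormSq) * (q - hexNormSq) +
      (c * (c * hexNormSq / 2 - 1) - 0.052) * (q - hexNormSq) ^ 2) ≤ vectorTerm c q := by
  have hq0 : 0 ≤ q := by linarith [(abs_le.1 hq).1, hexNormSq_mem_Icc.1]
  have hquad := quadratic_le_mul_cubic hc hc' hq
  rw [add_sub_cancel] at hquad
  have hcd : |c * (q - hexNormSq)| ≤ 1 := by
    rw [abs_mul, abs_of_nonneg (by linarith)]
    nlinarith [abs_nonneg (q - hexNormSq)]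
  calc _ ≤ exp (-c * hexNormSq) * (q * exp (-(c * (q - hexNormSq)))) := by
        gcongr
        exact hquad.trans (mul_le_mul_of_nonneg_left (cubic_le_exp_neg hcd) hq0)
    _ = vectorTerm c q := by
        rw [vectorTerm, mul_left_comm, ← exp_add]
        ring_nf

theorem first_shell_le {c q₁ q₂ q₃ : ℝ} (hc : 2.868 ≤ c) (hc' : c ≤ 2.8764)
    (h₁ : |q₁ - hexNormSq| ≤ 0.071) (h₂ : |q₂ - hexNormSq| ≤ 0.071)
    (h₃ : |q₃ - hexNormSq| ≤ 0.071) (hheron : heronForm q₁ q₂ q₃ = 4) :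
    exp (-c * hexNormSq) * (3 * hexNormSq - 0.205 * (q₁ + q₂ + q₃ - 3 * hexNormSq)) ≤
      vectorTerm c q₁ + vectorTerm c q₂ + vectorTerm c q₃ := by
  have hh := hexNormSq_mem_Icc.1
  have hexcess : 3 * hexNormSq ≤ q₁ + q₂ + q₃ := three_mul_hexNormSq_le_of_heronForm
    (by linarith [(abs_le.1 h₁).1, (abs_le.1 h₂).1, (abs_le.1 h₃).1]) hheron
  have hterms := add_le_add_three (quadratic_le_vectorTerm hc hc' h₁)
    (quadratic_le_vectorTerm hc hc' h₂) (quadratic_le_vectorTerm hc hc' h₃)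
  set s := c * hexNormSq with hs
  set κ := c * (s / 2 - 1) - 0.052 with hκ
  have hs_ge : 3.3116 ≤ s := by nlinarith
  have hslope : -0.205 ≤ 1 - s + κ * hexNormSq := by
    have hexpand : 1 - s + κ * hexNormSq = 1 - 2 * s + s ^ 2 / 2 - 0.052 * hexNormSq := by
      rw [hκ, hs]
      ring
    nlinarith
  have hcurvature := mul_le_mul_of_nonneg_left (hexNormSq_mul_sub_le_sum_sq hheron)
    (show 0 ≤ κ by nlinarith)
  have hlinear := mul_le_mul_of_nonneg_right hslope (sub_nonneg.2 hexcess)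
  refine le_trans ?_ hterms
  rw [← mul_add, ← mul_add]
  gcongr
  linarith

theorem tangent_le_vectorTerm {q : ℝ} (hq : 0 ≤ q) (c r : ℝ) :
    exp (-c * r) * (q * (1 - c * (q - r))) ≤ vectorTerm c q :=
  calc exp (-c * r) * (q * (1 - c * (q - r))) ≤ exp (-c * r) * (q * exp (-(c * (q - r)))) := by
        gcongr
        exact one_sub_le_exp_neg _
    _ = vectorTerm c q := by
        rw [vectorTerm, mul_left_comm, ← exp_add]
        ring_nf

theorem second_shell_le {c q₁ q₂ q₃ σ : ℝ} (hc' : c ≤ 2.8764)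
    (h₁ : 0 ≤ q₁) (h₂ : 0 ≤ q₂) (h₃ : 0 ≤ q₃) (hsum : q₁ + q₂ + q₃ = 3 * σ)
    (hσ : 3 * hexNormSq ≤ σ) (hσ' : σ ≤ 3 * hexNormSq + 0.0063)
    (hheron : heronForm q₁ q₂ q₃ = 36) :
    exp (-c * hexNormSq) ^ 3 * (9 * hexNormSq - 0.36) ≤
      vectorTerm c q₁ + vectorTerm c q₂ + vectorTerm c q₃ := by
  obtain ⟨ε, rfl⟩ : ∃ ε, σ = 3 * hexNormSq + ε := ⟨σ - 3 * hexNormSq, by ring⟩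
  have hterms := add_le_add_three (tangent_le_vectorTerm h₁ c (3 * hexNormSq))
    (tangent_le_vectorTerm h₂ c (3 * hexNormSq)) (tangent_le_vectorTerm h₃ c (3 * hexNormSq))
  rw [← mul_add, ← mul_add] at hterms
  rw [exp_neg_mul_hexNormSq_pow_three]
  refine le_trans ?_ hterms
  gcongr
  have hvariance : q₁ ^ 2 + q₂ ^ 2 + q₃ ^ 2 - 3 * hexNormSq * (q₁ + q₂ + q₃) =
      18 * hexNormSq * ε + 4.5 * ε ^ 2 := by
    rw [heronForm] at hheron
    linear_combination (-1 / 2) * hheron +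
      ((q₁ + q₂ + q₃ + 3 * (3 * hexNormSq + ε)) / 2 - 3 * hexNormSq) * hsum +
      4.5 * three_mul_hexNormSq_sq
  have hbound : c * (18 * hexNormSq * ε + 4.5 * ε ^ 2) ≤ 2.8764 * (20.82 * ε) := by
    obtain ⟨hh, hh'⟩ := hexNormSq_mem_Icc
    have hε : 0 ≤ ε := by linarith
    exact mul_le_mul hc' (by nlinarith) (by positivity) (by norm_num)
  calc 9 * hexNormSq - 0.36 ≤ 3 * (3 * hexNormSq + ε) -
        c * (18 * hexNormSq * ε + 4.5 * ε ^ 2) := by linarith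
    _ = _ := by
        rw [← hvariance, ← hsum]
        ring

theorem latticeM_I_le {α q : ℝ} (hα : 0 < α) (hq : exp (-π * α) ≤ q) (hq1 : q ≤ 0.0569) :
    latticeM α UpperHalfPlane.I ≤ 4 * q + 8 * q ^ 2 + 0.000195 := by
  have hq0 : 0 < q := (exp_pos _).trans_le hq
  have hq3 : q ^ 3 ≤ 0.000185 :=
    calc q ^ 3 ≤ 0.0569 ^ 3 := by gcongr
      _ ≤ 0.000185 := by norm_num
  have hq4 : q ^ 4 ≤ 0.0000105 :=
    calc q ^ 4 ≤ 0.0569 ^ 4 := by gcongr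
      _ ≤ 0.0000105 := by norm_num
  have hθ₀ : gaussMoment 0 α ≤ 1 + 2 * (q + 0.0000107) := by
    refine (gaussMoment_le hα Even.zero hq (by linarith)).trans ?_
    rw [pow_zero, pow_zero, one_mul]
    gcongr
    rw [div_le_iff₀ (by linarith)]
    nlinarith
  have hθ₂ : gaussMoment 2 α ≤ 2 * (q + 0.0000422) := by
    refine (gaussMoment_le hα even_two hq (by linarith)).trans ?_
    rw [zero_pow two_ne_zero, zero_add]
    gcongr
    rw [div_le_iff₀ (by linarith)]
    nlinarith
  calc latticeM α UpperHalfPlane.I = 2 * (gaussMoment 0 α * gaussMoment 2 α) := latticeM_I hα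
    _ ≤ 2 * ((1 + 2 * (q + 0.0000107)) * (2 * (q + 0.0000422))) := by
        have hθ₂_nonneg := gaussMoment_nonneg even_two α
        gcongr
    _ ≤ 4 * q + 8 * q ^ 2 + 0.000195 := by linarith

theorem exp_neg_le_of_le {c : ℝ} (hc : 2.868 ≤ c) (hc' : c ≤ 2.8764) :
    exp (-c) ≤ 0.0563375 * (1 + 1.0084 * (2.8764 - c)) := by
  obtain ⟨η, rfl⟩ : ∃ η, c = 2.8764 - η := ⟨2.8764 - c, by ring⟩
  have hη : 0 ≤ η := by linarith
  have hbase : exp (-2.8764) ≤ 0.0563375 :=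
    calc exp (-2.8764) = exp (0.1236 - (3 : ℕ)) := by norm_num
      _ ≤ 0.0563375 := (exp_sub_natCast_le 3 (by norm_num) (by norm_num)).trans (by norm_num)
  have hexp : exp η ≤ 1 + 1.0084 * η := by
    have htaylor := abs_exp_sub_one_sub_id_le (x := η) (by rw [abs_of_nonneg hη]; linarith)
    nlinarith [(abs_le.1 htaylor).2]
  calc exp (-(2.8764 - η)) = exp (-2.8764) * exp η := by
        rw [← exp_add]
        ring_nf
    _ ≤ 0.0563375 * (1 + 1.0084 * η) := by gcongr
    _ = _ := by ring

theorem le_exp_neg_mul_hexNormSq {c : ℝ} (hc : c ≤ 2.8764) :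
    0.036101 * (1 + 1.1547 * (2.8764 - c)) ≤ exp (-c * hexNormSq) := by
  obtain ⟨hh, hh'⟩ := hexNormSq_mem_Icc
  have hbase : 0.036101 ≤ exp (-3.32141) :=
    calc (0.036101 : ℝ) ≤ _ := by norm_num
      _ ≤ exp (0.67859 - (4 : ℕ)) := le_exp_sub_natCast 4 (by norm_num)
      _ = exp (-3.32141) := by norm_num
  calc 0.036101 * (1 + 1.1547 * (2.8764 - c))
      ≤ exp (-3.32141) * exp (1.1547 * (2.8764 - c)) := by
        gcongr
        linarith [add_one_le_exp (1.1547 * (2.8764 - c))]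
    _ ≤ exp (-c * hexNormSq) := by
        rw [← exp_add, exp_le_exp]
        nlinarith

theorem square_le_two_shells {c : ℝ} (hc : 2.868 ≤ c) (hc' : c ≤ 2.8764) :
    4 * (0.0563375 * (1 + 1.0084 * (2.8764 - c))) +
        8 * (0.0563375 * (1 + 1.0084 * (2.8764 - c))) ^ 2 + 0.000195 ≤
      2 * (exp (-c * hexNormSq) * (3 * hexNormSq - 0.0013)) +
        2 * (exp (-c * hexNormSq) ^ 3 * (9 * hexNormSq - 0.36)) := by
  have hh := hexNormSq_mem_Icc.1
  have hexp := le_exp_neg_mul_hexNormSq hc'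
  obtain ⟨η, rfl⟩ : ∃ η, c = 2.8764 - η := ⟨2.8764 - c, by ring⟩
  rw [sub_sub_cancel] at hexp ⊢
  set E := exp (-(2.8764 - η) * hexNormSq)
  have hE : 0.036101 ≤ E := by linarith
  have hfirst : 0.036101 * (1 + 1.1547 * η) * 3.4628 ≤ E * (3 * hexNormSq - 0.0013) := by
    gcongr
    linarith
  have hsecond : 0.036101 ^ 3 * 10.032 ≤ E ^ 3 * (9 * hexNormSq - 0.36) := by
    gcongr
    linarith
  have hsq : (1 + 1.0084 * η) ^ 2 ≤ 1 + 2.03 * η := by nlinarith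
  linarith

theorem near_hexagonal_bounds {α : ℝ} (hα : 0 < α) (hα₁ : α < 0.9155730607) {z : ℍ}
    (hz : z ∈ closedHalfDomain) (hω : z.im / α - α * z.im < 1 / (2 * π) - 0.0018) :
    0.913 ≤ α ∧ 0.4541 ≤ z.re ∧ z.im ∈ Icc 0.866 0.8909 := by
  obtain ⟨hx0, hx, hxy⟩ := hz
  have hy := z.im_pos
  have hp := one_div_two_pi_mem_Icc.2
  have hy1 : 0.866 ≤ z.im := by nlinarith
  have hgap : z.im * (1 - α ^ 2) < 0.157356 * α := by
    have heq : z.im / α - α * z.im = z.im * (1 - α ^ 2) / α := by field_simp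
    rw [← div_lt_iff₀ hα, ← heq]
    linarith
  have hα₂ : 0.913 ≤ α := by
    by_contra! h
    nlinarith [mul_le_mul hy1 (show 0.16643 ≤ 1 - α ^ 2 by nlinarith) (by norm_num) hy.le]
  have hy2 : z.im ≤ 0.8909 := by
    have h1 : 0.161725 ≤ 1 - α ^ 2 := by nlinarith
    nlinarith
  exact ⟨hα₂, by nlinarith, hy1, hy2⟩

theorem abs_div_sub_hexNormSq_le {N y : ℝ} (hy : 0 < y) (hN : 1.1 * y ≤ N)
    (hN' : N ≤ 1.22565 * y) : |N / y - hexNormSq| ≤ 0.071 := by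
  obtain ⟨hh, hh'⟩ := hexNormSq_mem_Icc
  have hlower := (le_div_iff₀ hy).2 hN
  have hupper := (div_le_iff₀ hy).2 hN'
  exact abs_le.2 ⟨by linarith, by linarith⟩

theorem first_shell_near_hexNormSq {z : ℍ} (hz : z ∈ closedHalfDomain) (hx : 0.4541 ≤ z.re)
    (hy : z.im ∈ Icc 0.866 0.8909) :
    |latticeNormSq z (1, 0) - hexNormSq| ≤ 0.071 ∧
      |latticeNormSq z (0, 1) - hexNormSq| ≤ 0.071 ∧
      |latticeNormSq z (1, -1) - hexNormSq| ≤ 0.071 := by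
  obtain ⟨-, hx', hxy⟩ := hz
  obtain ⟨hy1, hy2⟩ := hy
  have hprod : 0 ≤ (z.im - 0.866) * (0.8909 - z.im) := mul_nonneg (by linarith) (by linarith)
  have hxsq : z.re ^ 2 ≤ 0.25 := by nlinarith
  have hxsq' : (1 - z.re) ^ 2 ≤ 0.5459 ^ 2 := by
    apply sq_le_sq' <;> linarith
  refine ⟨?_, ?_, ?_⟩ <;>
    · rw [latticeNormSq]
      refine abs_div_sub_hexNormSq_le z.im_pos ?_ ?_ <;> push_cast <;> linarith

theorem first_shell_sum_le {z : ℍ} (hz : z ∈ closedHalfDomain) (hx : 0.4541 ≤ z.re)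
    (hy : z.im ∈ Icc 0.866 0.8909) :
    latticeNormSq z (1, 0) + latticeNormSq z (0, 1) + latticeNormSq z (1, -1) ≤
      3 * hexNormSq + 0.0063 := by
  obtain ⟨-, hx', -⟩ := hz
  obtain ⟨hy1, hy2⟩ := hy
  have hsum : latticeNormSq z (1, 0) + latticeNormSq z (0, 1) + latticeNormSq z (1, -1) =
      2 * (1 - z.re * (1 - z.re) + z.im ^ 2) / z.im := by
    simp only [latticeNormSq]
    push_cast
    ring
  have hxx : 0.24789 ≤ z.re * (1 - z.re) := by nlinarith
  have hhex := mul_le_mul_of_nonneg_right hexNormSq_mem_Icc.1 z.im_pos.le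
  rw [hsum, div_le_iff₀ z.im_pos]
  nlinarith [mul_nonneg (sub_nonneg.2 hy1) (sub_nonneg.2 hy2)]

theorem latticeM_I_le_of_near_hexagonal {α : ℝ} (hα : 0 < α) (hα₁ : α < 0.9155730607) {z : ℍ}
    (hz : z ∈ closedHalfDomain) (hω : z.im / α - α * z.im < 1 / (2 * π) - 0.0018) :
    latticeM α UpperHalfPlane.I ≤ latticeM α z := by
  obtain ⟨hα₂, hx, hy⟩ := near_hexagonal_bounds hα hα₁ hz hω
  have hc : 2.868 ≤ π * α := by nlinarith [pi_gt_d6]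
  have hc' : π * α ≤ 2.8764 := by nlinarith [pi_lt_d6]
  obtain ⟨h₁, h₂, h₃⟩ := first_shell_near_hexNormSq hz hx hy
  have hnonneg := latticeNormSq_nonneg z
  have hexcess := three_mul_hexNormSq_le_of_heronForm
    (add_nonneg (add_nonneg (hnonneg _) (hnonneg _)) (hnonneg _)) (heronForm_first_shell z)
  have hexcess' := first_shell_sum_le hz hx hy
  have hfirst := first_shell_le hc hc' h₁ h₂ h₃ (heronForm_first_shell z)
  have hsecond := second_shell_le hc' (hnonneg _) (hnonneg _) (hnonneg _) (second_shell_sum_eq z)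
    hexcess hexcess' (heronForm_second_shell z)
  calc latticeM α UpperHalfPlane.I
      ≤ 4 * (0.0563375 * (1 + 1.0084 * (2.8764 - π * α))) +
          8 * (0.0563375 * (1 + 1.0084 * (2.8764 - π * α))) ^ 2 + 0.000195 :=
        latticeM_I_le hα (by rw [neg_mul]; exact exp_neg_le_of_le hc hc') (by linarith)
    _ ≤ _ := square_le_two_shells hc hc'
    _ ≤ _ := by
        gcongr
        refine le_trans ?_ hfirst
        gcongr
        linarith
    _ ≤ latticeM α z := shells_le_latticeM hα z

/-! ### Small values of `α Im z` -/

theorem tsum_fourierCoeffM_le {X Z : ℝ} (hX : 0 < X) (hZ : 0 < Z) :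
    ∑' p : ℤ × ℤ, fourierCoeffM X Z p.1 p.2 ≤
      (1 / (2 * π) * gaussMoment 0 X + X * gaussMoment 2 X) * gaussMoment 0 Z := by
  have hsum := hasSum_quadratic_mul_gaussian_prod hX hZ (1 / (2 * π)) X 0
  calc ∑' p : ℤ × ℤ, fourierCoeffM X Z p.1 p.2 ≤ _ := by
        refine (summable_fourierCoeffM hX hZ).tsum_le_tsum (fun p => ?_) hsum.summable
        rw [fourierCoeffM]
        gcongr
        linarith [mul_nonneg hZ.le (sq_nonneg (p.2 : ℝ))]
    _ = _ := by
        rw [hsum.tsum_eq]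
        ring

theorem sq_mul_latticeM_le {α : ℝ} (hα : 0 < α) (hα₁ : α ≤ 1) {w : ℍ} (hre : w.re = 0)
    (him : w.im = 1 / α) : α ^ 2 * latticeM α w ≤ 0.283 := by
  have hX : α * w.im = 1 := by rw [him, mul_one_div_cancel hα.ne']
  have hZ : 1 ≤ w.im / α := by
    rw [him, le_div_iff₀ hα, one_mul]
    exact hα₁.trans ((one_le_div hα).2 hα₁)
  have hq : exp (-π * 1) ≤ 0.0434 := by rw [mul_one]; exact exp_neg_pi_le
  have hqZ : exp (-π * (w.im / α)) ≤ 0.0434 := by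
    refine le_trans (exp_le_exp.2 ?_) hq
    nlinarith [pi_pos]
  have hθ₀ : gaussMoment 0 1 ≤ 1.0869 :=
    (gaussMoment_le one_pos Even.zero hq (by norm_num)).trans (by norm_num)
  have hθ₂ : gaussMoment 2 1 ≤ 0.0869 :=
    (gaussMoment_le one_pos even_two hq (by norm_num)).trans (by norm_num)
  have hθ₀Z : gaussMoment 0 (w.im / α) ≤ 1.0869 :=
    (gaussMoment_le (one_pos.trans_le hZ) Even.zero hqZ (by norm_num)).trans (by norm_num)
  have hp : 1 / (2 * π) ≤ 0.1592 := by linarith [one_div_two_pi_mem_Icc.2]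
  calc α ^ 2 * latticeM α w = ∑' p : ℤ × ℤ, fourierCoeffM 1 (w.im / α) p.1 p.2 := by
        rw [sq_mul_latticeM hα, hX, hre, sqrt_one, one_mul, fourierSumM]
        simp only [mul_zero, cos_zero, mul_one]
    _ ≤ (1 / (2 * π) * gaussMoment 0 1 + 1 * gaussMoment 2 1) * gaussMoment 0 (w.im / α) :=
        tsum_fourierCoeffM_le one_pos (one_pos.trans_le hZ)
    _ ≤ (0.1592 * 1.0869 + 1 * 0.0869) * 1.0869 := by
        have hθ₀_nonneg := gaussMoment_nonneg Even.zero 1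
        have hθ₀Z_nonneg := gaussMoment_nonneg Even.zero (w.im / α)
        gcongr
    _ ≤ 0.283 := by norm_num

theorem hasSum_ite_snd_eq_zero {f : ℤ → ℝ} {a : ℝ} (hf : HasSum f a) :
    HasSum (fun p : ℤ × ℤ => if p.2 = 0 then f p.1 else 0) a := by
  have hinj : Function.Injective fun n : ℤ => ((n, 0) : ℤ × ℤ) := Prod.mk_left_injective 0
  refine (hinj.hasSum_iff ?_).1 (by simpa [Function.comp_def] using hf)
  rintro ⟨m, k⟩ hmk
  refine if_neg ?_
  rintro rfl
  exact hmk ⟨m, rfl⟩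

theorem abs_fourierCoeffM_mul_cos_le {X Z : ℝ} (hX : 0 ≤ X) (hZ : 0 ≤ Z) (m k φ : ℝ) :
    |fourierCoeffM X Z m k * cos φ| ≤
      (1 / (2 * π) + X * m ^ 2 + Z * k ^ 2) * exp (-π * (X * m ^ 2 + Z * k ^ 2)) := by
  rw [fourierCoeffM, abs_mul, abs_mul, abs_exp]
  refine (mul_le_of_le_one_right (by positivity) (abs_cos_le_one φ)).trans ?_
  gcongr
  refine (abs_sub _ _).trans_eq ?_
  rw [abs_of_nonneg (by positivity), abs_of_nonneg (by positivity)]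

/-- The terms with `k = 0` are kept, all others are replaced by minus their absolute values. -/
theorem le_fourierSumM {X Z : ℝ} (hX : 0 < X) (hZ : 0 < Z) (x : ℝ) :
    (1 / (2 * π) * gaussMoment 0 X + X * gaussMoment 2 X) * (2 - gaussMoment 0 Z) -
        gaussMoment 0 X * (Z * gaussMoment 2 Z) ≤ fourierSumM X Z x := by
  have habs := hasSum_quadratic_mul_gaussian_prod hX hZ (1 / (2 * π)) X Z
  have hrow := hasSum_ite_snd_eq_zero ((((hasSum_gaussMoment hX 0).mul_left (1 / (2 * π))).add
    ((hasSum_gaussMoment hX 2).mul_left X)).mul_left 2)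
  have hlower := hrow.sub habs
  calc _ = _ := by ring
    _ = _ := hlower.tsum_eq.symm
    _ ≤ _ := by
      refine hlower.summable.tsum_le_tsum (fun p => ?_)
        (hasSum_fourierSumM hX hZ x).summable
      have hterm := neg_le_of_abs_le
        (abs_fourierCoeffM_mul_cos_le hX.le hZ.le p.1 p.2 (2 * π * p.1 * p.2 * x))
      split_ifs with hk
      · simp only [fourierCoeffM, hk, Int.cast_zero, mul_zero, zero_mul, cos_zero]
        apply le_of_eq
        ring_nf
      · linarith

theorem le_sqrt_mul_gaussMoment {X : ℝ} (hX : 0 < X) (hX' : X ≤ 1 / 4) :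
    0.3129 ≤ √X * (1 / (2 * π) * gaussMoment 0 X + X * gaussMoment 2 X) := by
  have hinv : 3 ≤ X⁻¹ := by
    rw [le_inv_comm₀ three_pos hX]
    linarith
  have hθ₀ := one_le_gaussMoment_zero (inv_pos.2 hX)
  have hθ₂ := mul_gaussMoment_two_le_of_three_le hinv
  have hpoisson := sqrt_mul_gaussMoment hX (1 / (2 * π)) 1
  rw [one_mul, one_mul] at hpoisson
  rw [hpoisson]
  nlinarith [one_div_two_pi_mem_Icc.1]

theorem le_sq_mul_latticeM {α : ℝ} (hα : 0 < α) {z : ℍ} (hX : α * z.im ≤ 1 / 4)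
    (hy : 3 / 4 ≤ z.im ^ 2) : 0.3 ≤ α ^ 2 * latticeM α z := by
  have hX0 : 0 < α * z.im := mul_pos hα z.im_pos
  have hZ : 3 ≤ z.im / α := by
    rw [le_div_iff₀ hα]
    nlinarith [z.im_pos]
  have hinv : 3 ≤ (α * z.im)⁻¹ := by
    rw [le_inv_comm₀ three_pos hX0]
    linarith
  rw [sq_mul_latticeM hα]
  set X := α * z.im
  set Z := z.im / α
  have hZ0 : 0 < Z := by linarith
  have hrow := le_sqrt_mul_gaussMoment hX0 hX
  set S := √X * (1 / (2 * π) * gaussMoment 0 X + X * gaussMoment 2 X)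
  have hpoisson : √X * gaussMoment 0 X = gaussMoment 0 X⁻¹ := by
    simpa using sqrt_mul_gaussMoment hX0 1 0
  have hθ₀ : 0 ≤ 2 - gaussMoment 0 Z - 0.9949 := by
    linarith [gaussMoment_zero_le_of_three_le hZ]
  have hθ₂ := mul_gaussMoment_two_le_of_three_le hZ
  calc (0.3 : ℝ) ≤ 0.3129 * 0.9949 - 1.0051 * 0.0051 := by norm_num
    _ ≤ S * (2 - gaussMoment 0 Z) - gaussMoment 0 X⁻¹ * (Z * gaussMoment 2 Z) := by
        have hθ₂_nonneg : 0 ≤ Z * gaussMoment 2 Z :=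
          mul_nonneg hZ0.le (gaussMoment_nonneg even_two Z)
        gcongr
        · linarith
        · exact gaussMoment_zero_le_of_three_le hinv
    _ = √X * ((1 / (2 * π) * gaussMoment 0 X + X * gaussMoment 2 X) * (2 - gaussMoment 0 Z) -
          gaussMoment 0 X * (Z * gaussMoment 2 Z)) := by
        rw [← hpoisson]
        ring
    _ ≤ _ := by
        gcongr
        exact le_fourierSumM hX0 hZ0 z.re

/-! ### Monotonicity along horizontal lines -/

theorem abs_sin_natCast_mul_le (n : ℕ) (t : ℝ) : |sin (n * t)| ≤ n * |sin t| := by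
  induction n with
  | zero => simp
  | succ n ih =>
    rw [Nat.cast_succ, add_mul, one_mul, sin_add, add_mul, one_mul]
    refine (abs_add_le _ _).trans (add_le_add ?_ ?_)
    · rw [abs_mul]
      exact (mul_le_of_le_one_right (abs_nonneg _) (abs_cos_le_one _)).trans ih
    · rw [abs_mul]
      exact mul_le_of_le_one_left (abs_nonneg _) (abs_cos_le_one _)

theorem abs_cos_natCast_mul_sub_le (n : ℕ) (u v : ℝ) :
    |cos (n * u) - cos (n * v)| ≤ n ^ 2 * |cos u - cos v| := by
  rw [cos_sub_cos, cos_sub_cos, ← mul_add, ← mul_sub, mul_div_assoc, mul_div_assoc]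
  simp only [abs_mul]
  calc |(-2 : ℝ)| * |sin (n * ((u + v) / 2))| * |sin (n * ((u - v) / 2))|
      ≤ |(-2 : ℝ)| * (n * |sin ((u + v) / 2)|) * (n * |sin ((u - v) / 2)|) := by
        gcongr <;> exact abs_sin_natCast_mul_le n _
    _ = n ^ 2 * (|(-2 : ℝ)| * |sin ((u + v) / 2)| * |sin ((u - v) / 2)|) := by ring

theorem tsum_int_eq_two_mul_tsum_succ {f : ℤ → ℝ} (hf : Summable f) (heven : f.Even)
    (hzero : f 0 = 0) : ∑' n, f n = 2 * ∑' n : ℕ, f (n + 1) := by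
  rw [tsum_int_eq_zero_add_two_mul_tsum_pnat heven hf,
    tsum_pnat_eq_tsum_succ (f := fun n : ℕ => f n), hzero, zero_add, nsmul_eq_mul, Nat.cast_ofNat]
  simp only [Nat.cast_add, Nat.cast_one]

theorem summable_comp_succ_prod {F : ℤ × ℤ → ℝ} (hF : Summable F) :
    Summable fun p : ℕ × ℕ => F (p.1 + 1, p.2 + 1) := by
  refine hF.comp_injective (i := fun p : ℕ × ℕ => ((p.1 : ℤ) + 1, (p.2 : ℤ) + 1)) ?_
  rintro ⟨i, j⟩ ⟨i', j'⟩ h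
  simpa using h

theorem tsum_eq_four_mul_tsum_succ_prod {F : ℤ × ℤ → ℝ} (hF : Summable F)
    (heven₁ : ∀ m k, F (-m, k) = F (m, k)) (heven₂ : ∀ m k, F (m, -k) = F (m, k))
    (hzero₁ : ∀ k, F (0, k) = 0) (hzero₂ : ∀ m, F (m, 0) = 0) :
    ∑' p, F p = 4 * ∑' p : ℕ × ℕ, F (p.1 + 1, p.2 + 1) := by
  have hrow (m : ℤ) : ∑' k, F (m, k) = 2 * ∑' j : ℕ, F (m, j + 1) :=
    tsum_int_eq_two_mul_tsum_succ (hF.prod_factor m) (heven₂ m) (hzero₂ m)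
  rw [hF.tsum_prod, (summable_comp_succ_prod hF).tsum_prod,
    tsum_int_eq_two_mul_tsum_succ hF.prod (fun m => by simp only [heven₁])
      (by simp only [hzero₁, tsum_zero])]
  simp only [hrow, tsum_mul_left]
  ring

/-- The term of index `(m, k)` in `fourierSumM X Z x₂ - fourierSumM X Z x₁`. -/
noncomputable def fourierDiffM (X Z x₁ x₂ m k : ℝ) : ℝ :=
  fourierCoeffM X Z m k * (cos (2 * π * m * k * x₂) - cos (2 * π * m * k * x₁))

theorem fourierDiffM_neg_left (X Z x₁ x₂ m k : ℝ) :
    fourierDiffM X Z x₁ x₂ (-m) k = fourierDiffM X Z x₁ x₂ m k := by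
  simp only [fourierDiffM, fourierCoeffM, even_two.neg_pow, mul_neg, neg_mul, cos_neg]

theorem fourierDiffM_neg_right (X Z x₁ x₂ m k : ℝ) :
    fourierDiffM X Z x₁ x₂ m (-k) = fourierDiffM X Z x₁ x₂ m k := by
  simp only [fourierDiffM, fourierCoeffM, even_two.neg_pow, mul_neg, neg_mul, cos_neg]

theorem hasSum_fourierDiffM {X Z : ℝ} (hX : 0 < X) (hZ : 0 < Z) (x₁ x₂ : ℝ) :
    HasSum (fun p : ℕ × ℕ => 4 * fourierDiffM X Z x₁ x₂ (p.1 + 1) (p.2 + 1))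
      (fourierSumM X Z x₂ - fourierSumM X Z x₁) := by
  set F : ℤ × ℤ → ℝ := fun p => fourierDiffM X Z x₁ x₂ p.1 p.2
  have hF : HasSum F (fourierSumM X Z x₂ - fourierSumM X Z x₁) :=
    ((hasSum_fourierSumM hX hZ x₂).sub (hasSum_fourierSumM hX hZ x₁)).congr_fun fun p => by
      simp only [F, fourierDiffM, mul_sub]
  have hfour := tsum_eq_four_mul_tsum_succ_prod hF.summable
    (fun m k => by simp only [F, Int.cast_neg, fourierDiffM_neg_left])
    (fun m k => by simp only [F, Int.cast_neg, fourierDiffM_neg_right])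
    (fun k => by simp [F, fourierDiffM]) (fun m => by simp [F, fourierDiffM])
  rw [← hF.tsum_eq, hfour]
  refine ((summable_comp_succ_prod hF.summable).hasSum.mul_left 4).congr_fun fun p => ?_
  simp only [F, Int.cast_add, Int.cast_natCast, Int.cast_one]

theorem fourierSumM_le_of_majorant {X Z : ℝ} (hX : 0 < X) (hZ : 0 < Z) {x₁ x₂ : ℝ}
    {g : ℕ × ℕ → ℝ} {G : ℝ} (hg : HasSum g G) (hG : G ≤ 0)
    (h : ∀ p : ℕ × ℕ, -fourierDiffM X Z x₁ x₂ (p.1 + 1) (p.2 + 1) ≤ g p) :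
    fourierSumM X Z x₁ ≤ fourierSumM X Z x₂ := by
  have hle := hasSum_le (fun p => by linarith [h p]) (hasSum_fourierDiffM hX hZ x₁ x₂).neg
    (hg.mul_left 4)
  linarith

theorem latticeM_le_of_fourierSumM_le {α : ℝ} (hα : 0 < α) {z w : ℍ} (him : w.im = z.im)
    (h : fourierSumM (α * z.im) (z.im / α) w.re ≤ fourierSumM (α * z.im) (z.im / α) z.re) :
    latticeM α w ≤ latticeM α z := by
  have hα2 : 0 < α ^ 2 := pow_pos hα 2
  rw [← mul_le_mul_iff_right₀ hα2, sq_mul_latticeM hα, sq_mul_latticeM hα, him]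
  gcongr

/-- The normalized weight `m² (t (m² - 1))ʲ exp (-π t (m² - 1))` with `m = i + 1`, so that
`modeWeight 0 t 0 = 1`. Products of two such weights dominate `fourierDiffM`. -/
noncomputable def modeWeight (j : ℕ) (t : ℝ) (i : ℕ) : ℝ :=
  ((i : ℝ) + 1) ^ 2 * (t * (((i : ℝ) + 1) ^ 2 - 1)) ^ j * exp (-π * t * (((i : ℝ) + 1) ^ 2 - 1))

/-- The sum over `m ≥ 1` of the weights `modeWeight j t`. -/
noncomputable def modeMass (j : ℕ) (t : ℝ) : ℝ :=
  ∑' i, modeWeight j t i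

theorem succ_sq_sub_one_nonneg (i : ℕ) : 0 ≤ ((i : ℝ) + 1) ^ 2 - 1 := by
  nlinarith [i.cast_nonneg (α := ℝ)]

theorem modeWeight_nonneg (j : ℕ) {t : ℝ} (ht : 0 ≤ t) (i : ℕ) : 0 ≤ modeWeight j t i := by
  have := succ_sq_sub_one_nonneg i
  rw [modeWeight]
  positivity

theorem modeMass_nonneg (j : ℕ) {t : ℝ} (ht : 0 ≤ t) : 0 ≤ modeMass j t :=
  tsum_nonneg (modeWeight_nonneg j ht)

theorem modeWeight_zero_right (j : ℕ) (t : ℝ) : modeWeight j t 0 = 0 ^ j := by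
  simp [modeWeight]

theorem modeWeight_one (j : ℕ) (t : ℝ) :
    modeWeight j t 1 = 4 * (3 * t) ^ j * exp (-(3 * π * t)) := by
  rw [modeWeight, Nat.cast_one, one_add_one_eq_two]
  ring_nf

theorem modeWeight_succ (j : ℕ) (t : ℝ) (i : ℕ) : modeWeight j t (i + 1) =
    ((i : ℝ) + 2) ^ 2 * (t * (((i : ℝ) + 2) ^ 2 - 1)) ^ j *
      exp (-π * t * (((i : ℝ) + 2) ^ 2 - 1)) := by
  rw [modeWeight, Nat.cast_succ, add_assoc, one_add_one_eq_two]

theorem summable_modeWeight (j : ℕ) {t : ℝ} (ht : 0 < t) : Summable (modeWeight j t) := by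
  have hmoment : Summable fun i : ℕ =>
      (((i + 1 : ℕ) : ℤ) : ℝ) ^ (2 + 2 * j) * exp (-π * t * (((i + 1 : ℕ) : ℤ) : ℝ) ^ 2) :=
    (hasSum_gaussMoment ht (2 + 2 * j)).summable.comp_injective
      (Nat.cast_injective.comp Nat.succ_injective)
  refine Summable.of_nonneg_of_le (modeWeight_nonneg j ht.le) (fun i => ?_)
    (hmoment.mul_left (t ^ j * exp (π * t)))
  have hexp : exp (-π * t * (((i : ℝ) + 1) ^ 2 - 1)) =
      exp (π * t) * exp (-π * t * ((i : ℝ) + 1) ^ 2) := by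
    rw [← exp_add]
    ring_nf
  have hi := succ_sq_sub_one_nonneg i
  push_cast
  calc modeWeight j t i ≤ ((i : ℝ) + 1) ^ 2 * (t * ((i : ℝ) + 1) ^ 2) ^ j *
        (exp (π * t) * exp (-π * t * ((i : ℝ) + 1) ^ 2)) := by
        rw [modeWeight, hexp]
        gcongr
        linarith
    _ = _ := by
        rw [mul_pow, pow_add, pow_mul]
        ring

theorem sq_add_two_le (i : ℕ) : ((i : ℝ) + 2) ^ 2 ≤ 4 * (9 / 4) ^ i := by
  have hbernoulli := one_add_mul_le_pow (a := (1 / 2 : ℝ)) (by norm_num) i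
  calc ((i : ℝ) + 2) ^ 2 = 4 * (1 + i * (1 / 2)) ^ 2 := by ring
    _ ≤ 4 * ((1 + 1 / 2) ^ i) ^ 2 := by gcongr
    _ = 4 * (9 / 4) ^ i := by
        rw [pow_right_comm]
        norm_num

theorem sq_add_two_sub_one_le (i : ℕ) : ((i : ℝ) + 2) ^ 2 - 1 ≤ 3 * (8 / 3) ^ i := by
  induction i with
  | zero => norm_num
  | succ i ih =>
    rw [pow_succ (8 / 3 : ℝ), Nat.cast_succ]
    nlinarith [i.cast_nonneg (α := ℝ)]

theorem exp_neg_mul_sq_add_two_le {t : ℝ} (ht : 0 ≤ t) (i : ℕ) :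
    exp (-π * t * (((i : ℝ) + 2) ^ 2 - 1)) ≤ exp (-(3 * π * t)) * exp (-(5 * π * t)) ^ i := by
  rw [← exp_nat_mul, ← exp_add, exp_le_exp]
  have hi : (i : ℝ) ≤ (i : ℝ) ^ 2 := by exact_mod_cast Nat.le_self_pow two_ne_zero i
  nlinarith [mul_le_mul_of_nonneg_left hi (mul_nonneg pi_nonneg ht)]

theorem modeMass_le (j : ℕ) {t H r : ℝ} (ht : 0 < t) (hH : exp (-(5 * π * t)) ≤ H)
    (hr : exp (-(3 * π * t)) ≤ r) (hH1 : 9 / 4 * (8 / 3) ^ j * H < 1) :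
    modeMass j t ≤ 0 ^ j + 4 * (3 * t) ^ j * r / (1 - 9 / 4 * (8 / 3) ^ j * H) := by
  have hH0 : 0 < H := (exp_pos _).trans_le hH
  have hr0 : 0 < r := (exp_pos _).trans_le hr
  have hgeom := (hasSum_geometric_of_lt_one (by positivity) hH1).mul_left (4 * (3 * t) ^ j * r)
  have hterm (i : ℕ) :
      modeWeight j t (i + 1) ≤ 4 * (3 * t) ^ j * r * (9 / 4 * (8 / 3) ^ j * H) ^ i := by
    have hsq : 0 ≤ ((i : ℝ) + 2) ^ 2 - 1 := by nlinarith [i.cast_nonneg (α := ℝ)]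
    calc modeWeight j t (i + 1)
        ≤ 4 * (9 / 4) ^ i * (t * (3 * (8 / 3) ^ i)) ^ j * (r * H ^ i) := by
          rw [modeWeight_succ]
          gcongr
          · exact sq_add_two_le i
          · exact sq_add_two_sub_one_le i
          · exact (exp_neg_mul_sq_add_two_le ht.le i).trans (by gcongr)
      _ = 4 * (3 * t) ^ j * r * (9 / 4 * (8 / 3) ^ j * H) ^ i := by
          simp only [mul_pow, pow_right_comm (8 / 3 : ℝ) i j]
          ring
  have hs := summable_modeWeight j ht
  rw [modeMass, hs.tsum_eq_zero_add, modeWeight_zero_right, div_eq_mul_inv]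
  gcongr
  exact hasSum_le hterm ((summable_nat_add_iff 1).2 hs).hasSum hgeom

theorem pow_mul_exp_neg_mul_le (j : ℕ) {a s t : ℝ} (hs : 0 < s) (hst : s ≤ t) (hj : j ≤ a * s) :
    t ^ j * exp (-(a * t)) ≤ s ^ j * exp (-(a * s)) := by
  have ht : t ≤ s * exp (t / s - 1) := by
    rw [← div_le_iff₀' hs]
    linarith [add_one_le_exp (t / s - 1)]
  have hexp : j * (t / s - 1) ≤ a * (t - s) := by
    calc j * (t / s - 1) ≤ a * s * (t / s - 1) := by
          gcongr
          rwa [sub_nonneg, one_le_div hs]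
      _ = a * (t - s) := by field_simp
  calc t ^ j * exp (-(a * t)) ≤ (s * exp (t / s - 1)) ^ j * exp (-(a * t)) := by
        have ht0 : 0 ≤ t := hs.le.trans hst
        gcongr
    _ = s ^ j * exp (j * (t / s - 1) + -(a * t)) := by
        rw [mul_pow, ← exp_nat_mul, exp_add]
        ring
    _ ≤ s ^ j * exp (-(a * s)) := by
        gcongr
        linarith

theorem modeMass_le_modeMass (j : ℕ) {s t : ℝ} (hs : 0 < s) (hst : s ≤ t) (hj : j ≤ 3 * π * s) :
    modeMass j t ≤ modeMass j s := by
  refine (summable_modeWeight j (hs.trans_le hst)).tsum_le_tsum (fun i => ?_)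
    (summable_modeWeight j hs)
  rcases i with _ | i
  · rw [modeWeight_zero_right, modeWeight_zero_right]
  · have hc : 3 ≤ ((i : ℝ) + 2) ^ 2 - 1 := by nlinarith [i.cast_nonneg (α := ℝ)]
    rw [modeWeight_succ, modeWeight_succ]
    set c := ((i : ℝ) + 2) ^ 2 - 1
    have hdecay := pow_mul_exp_neg_mul_le j (a := π * c) hs hst <| hj.trans <| by
      nlinarith [mul_pos pi_pos hs]
    calc _ = ((i : ℝ) + 2) ^ 2 * c ^ j * (t ^ j * exp (-(π * c * t))) := by ring_nf
      _ ≤ ((i : ℝ) + 2) ^ 2 * c ^ j * (s ^ j * exp (-(π * c * s))) := by gcongr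
      _ = _ := by ring_nf

/-- The number `ω` for which the Fourier coefficient of index `(1, 1)` is `-ω exp (-π (X + Z))`.
Its sign and size decide whether moving to the left along a horizontal line decreases
`fourierSumM`. -/
noncomputable def leadCoeff (X Z : ℝ) : ℝ :=
  Z - X - 1 / (2 * π)

theorem fourierCoeffM_eq_exp_mul (X Z m k : ℝ) : fourierCoeffM X Z m k =
    exp (-π * (X + Z)) * ((X * (m ^ 2 - 1) - Z * (k ^ 2 - 1) - leadCoeff X Z) *
      (exp (-π * X * (m ^ 2 - 1)) * exp (-π * Z * (k ^ 2 - 1)))) := by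
  have hexp : exp (-π * (X * m ^ 2 + Z * k ^ 2)) = exp (-π * (X + Z)) *
      (exp (-π * X * (m ^ 2 - 1)) * exp (-π * Z * (k ^ 2 - 1))) := by
    rw [← exp_add, ← exp_add]
    ring_nf
  rw [fourierCoeffM, hexp, leadCoeff]
  ring

/-- A majorant of `fourierDiffM` relative to `exp (-π (X + Z)) |cos (2π x₁) - cos (2π x₂)|`, where
`p = (i, j)` stands for the index `(i + 1, j + 1)`. -/
noncomputable def fourierMajorant (X Z : ℝ) (p : ℕ × ℕ) : ℝ :=
  |leadCoeff X Z| * (modeWeight 0 X p.1 * modeWeight 0 Z p.2) +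
    modeWeight 1 X p.1 * modeWeight 0 Z p.2 + modeWeight 0 X p.1 * modeWeight 1 Z p.2

theorem fourierMajorant_zero (X Z : ℝ) : fourierMajorant X Z (0, 0) = |leadCoeff X Z| := by
  simp [fourierMajorant, modeWeight_zero_right]

theorem fourierMajorant_one_zero (X Z : ℝ) : fourierMajorant X Z (1, 0) =
    (4 * |leadCoeff X Z| + 12 * X) * exp (-(3 * π * X)) := by
  simp only [fourierMajorant, modeWeight_zero_right, modeWeight_one]
  ring

theorem hasSum_fourierMajorant {X Z : ℝ} (hX : 0 < X) (hZ : 0 < Z) :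
    HasSum (fourierMajorant X Z) (|leadCoeff X Z| * (modeMass 0 X * modeMass 0 Z) +
      modeMass 1 X * modeMass 0 Z + modeMass 0 X * modeMass 1 Z) := by
  have hprod (i j : ℕ) : HasSum (fun p : ℕ × ℕ => modeWeight i X p.1 * modeWeight j Z p.2)
      (modeMass i X * modeMass j Z) :=
    (summable_modeWeight i hX).hasSum.mul (summable_modeWeight j hZ).hasSum
      ((summable_modeWeight i hX).mul_of_nonneg (summable_modeWeight j hZ)
        (modeWeight_nonneg i hX.le) (modeWeight_nonneg j hZ.le))
  exact (((hprod 0 0).mul_left _).add (hprod 1 0)).add (hprod 0 1)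

theorem abs_cos_sub_le_succ_mul_succ (i j : ℕ) (x₁ x₂ : ℝ) :
    |cos (2 * π * (i + 1) * (j + 1) * x₂) - cos (2 * π * (i + 1) * (j + 1) * x₁)| ≤
      ((i + 1) ^ 2 * (j + 1) ^ 2) * |cos (2 * π * x₁) - cos (2 * π * x₂)| := by
  have hcos := abs_cos_natCast_mul_sub_le ((i + 1) * (j + 1)) (2 * π * x₂) (2 * π * x₁)
  rw [abs_sub_comm (cos (2 * π * x₂))] at hcos
  push_cast at hcos
  convert hcos using 2 <;> ring_nf

theorem neg_fourierDiffM_le_majorant {X Z : ℝ} (hX : 0 ≤ X) (hZ : 0 ≤ Z) (x₁ x₂ : ℝ)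
    (p : ℕ × ℕ) : -fourierDiffM X Z x₁ x₂ (p.1 + 1) (p.2 + 1) ≤
      exp (-π * (X + Z)) * |cos (2 * π * x₁) - cos (2 * π * x₂)| * fourierMajorant X Z p := by
  have hcos := abs_cos_sub_le_succ_mul_succ p.1 p.2 x₁ x₂
  refine (neg_le_abs _).trans ?_
  rw [fourierDiffM, fourierCoeffM_eq_exp_mul]
  simp only [fourierMajorant, modeWeight]
  have hm := mul_nonneg hX (succ_sq_sub_one_nonneg p.1)
  have hk := mul_nonneg hZ (succ_sq_sub_one_nonneg p.2)
  set m : ℝ := p.1 + 1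
  set k : ℝ := p.2 + 1
  set ω := leadCoeff X Z
  have hcoeff : |X * (m ^ 2 - 1) - Z * (k ^ 2 - 1) - ω| ≤
      |ω| + X * (m ^ 2 - 1) + Z * (k ^ 2 - 1) :=
    abs_le.2 ⟨by linarith [le_abs_self ω], by linarith [neg_abs_le ω]⟩
  simp only [abs_mul, abs_exp]
  calc _ ≤ exp (-π * (X + Z)) * ((|ω| + X * (m ^ 2 - 1) + Z * (k ^ 2 - 1)) *
        (exp (-π * X * (m ^ 2 - 1)) * exp (-π * Z * (k ^ 2 - 1)))) *
        (m ^ 2 * k ^ 2 * |cos (2 * π * x₁) - cos (2 * π * x₂)|) := by gcongr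
    _ = _ := by ring

theorem neg_fourierDiffM_one_one (X Z x₁ x₂ : ℝ) : -fourierDiffM X Z x₁ x₂ 1 1 =
    -(exp (-π * (X + Z)) * (cos (2 * π * x₁) - cos (2 * π * x₂)) * leadCoeff X Z) := by
  rw [fourierDiffM, fourierCoeffM_eq_exp_mul]
  simp only [one_pow, sub_self, mul_zero, exp_zero, mul_one]
  ring

theorem neg_fourierDiffM_two_one (X Z x₁ x₂ : ℝ) : -fourierDiffM X Z x₁ x₂ 2 1 =
    exp (-π * (X + Z)) * (cos (2 * π * x₁) - cos (2 * π * x₂)) *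
      (2 * (3 * X - leadCoeff X Z) * (cos (2 * π * x₁) + cos (2 * π * x₂)) *
        exp (-(3 * π * X))) := by
  have hexp : exp (-π * X * (2 ^ 2 - 1)) = exp (-(3 * π * X)) := by ring_nf
  have hcos (x : ℝ) : cos (2 * π * 2 * 1 * x) = 2 * cos (2 * π * x) ^ 2 - 1 := by
    rw [← cos_two_mul]
    ring_nf
  rw [fourierDiffM, fourierCoeffM_eq_exp_mul, hexp, hcos, hcos]
  simp only [one_pow, sub_self, mul_zero, exp_zero, mul_one]
  ring

theorem cos_two_pi_mul_le_cos {x₁ x₂ : ℝ} (h₁ : 0 ≤ x₁) (h₁₂ : x₁ ≤ x₂) (h₂ : x₂ ≤ 1 / 2) :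
    cos (2 * π * x₂) ≤ cos (2 * π * x₁) := by
  apply cos_le_cos_of_nonneg_of_le_pi (by positivity)
  · nlinarith [pi_pos]
  · gcongr

/-- The term of index `(1, 1)` dominates. It is treated exactly, and so is the one of index
`(2, 1)`, whose contribution `b` is negative when `x₁` and `x₂` are at least `1 / 4`. -/
theorem fourierSumM_le_of_modeMass_le {X Z x₁ x₂ : ℝ} (hX : 0 < X) (hZ : 0 < Z) (h₁ : 0 ≤ x₁)
    (h₁₂ : x₁ ≤ x₂) (h₂ : x₂ ≤ 1 / 2) {a₀ a₁ b₀ b₁ b : ℝ}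
    (ha₀ : modeMass 0 X ≤ a₀) (ha₁ : modeMass 1 X ≤ a₁)
    (hb₀ : modeMass 0 Z ≤ b₀) (hb₁ : modeMass 1 Z ≤ b₁)
    (hb : 2 * (3 * X - leadCoeff X Z) * (cos (2 * π * x₁) + cos (2 * π * x₂)) ≤ b)
    (hsum : |leadCoeff X Z| * (a₀ * b₀) + a₁ * b₀ + a₀ * b₁ + (-leadCoeff X Z - |leadCoeff X Z|) +
      (b - (4 * |leadCoeff X Z| + 12 * X)) * exp (-(3 * π * X)) ≤ 0) :
    fourierSumM X Z x₁ ≤ fourierSumM X Z x₂ := by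
  set Δ := exp (-π * (X + Z)) * |cos (2 * π * x₁) - cos (2 * π * x₂)|
  have hΔ : Δ = exp (-π * (X + Z)) * (cos (2 * π * x₁) - cos (2 * π * x₂)) := by
    rw [← abs_of_nonneg (sub_nonneg.2 (cos_two_pi_mul_le_cos h₁ h₁₂ h₂))]
  have hΔ_nonneg : 0 ≤ Δ := by positivity
  have hmajorant := (((hasSum_fourierMajorant hX hZ).add
    (hasSum_ite_eq (0, 0) (-leadCoeff X Z - |leadCoeff X Z|))).add
    (hasSum_ite_eq (1, 0) ((b - (4 * |leadCoeff X Z| + 12 * X)) * exp (-(3 * π * X))))).mul_left Δ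
  refine fourierSumM_le_of_majorant hX hZ hmajorant
    (mul_nonpos_of_nonneg_of_nonpos hΔ_nonneg (le_trans ?_ hsum)) ?_
  · have hX₀ := modeMass_nonneg 0 hX.le
    have hX₁ := modeMass_nonneg 1 hX.le
    have hZ₀ := modeMass_nonneg 0 hZ.le
    have hZ₁ := modeMass_nonneg 1 hZ.le
    have ha₀_nonneg := hX₀.trans ha₀
    have ha₁_nonneg := hX₁.trans ha₁
    gcongr
  · rintro ⟨i, j⟩
    by_cases h00 : (i, j) = (0, 0)
    · obtain ⟨rfl, rfl⟩ := Prod.mk.inj h00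
      rw [if_pos rfl, if_neg (by simp), fourierMajorant_zero, Nat.cast_zero, zero_add,
        neg_fourierDiffM_one_one, ← hΔ]
      apply le_of_eq
      ring
    by_cases h10 : (i, j) = (1, 0)
    · obtain ⟨rfl, rfl⟩ := Prod.mk.inj h10
      rw [if_neg h00, if_pos rfl, fourierMajorant_one_zero, Nat.cast_zero, Nat.cast_one, zero_add,
        one_add_one_eq_two, neg_fourierDiffM_two_one, ← hΔ, add_zero, ← add_mul,
        add_sub_cancel]
      gcongr
    · rw [if_neg h00, if_neg h10, add_zero, add_zero]
      exact neg_fourierDiffM_le_majorant hX.le hZ.le x₁ x₂ (i, j)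

theorem exp_neg_mul_natCast_div_four_le {a b : ℝ} (n : ℕ) (h : exp (-(a * (1 / 4))) ≤ b) :
    exp (-(a * (n / 4))) ≤ b ^ n := by
  calc exp (-(a * (n / 4))) = exp (-(a * (1 / 4))) ^ n := by
        rw [← exp_nat_mul]
        ring_nf
    _ ≤ b ^ n := by gcongr

theorem exp_neg_five_pi_half_le : exp (-(5 * π * (1 / 2))) ≤ 0.00056 := by
  have h := exp_neg_mul_natCast_div_four_le 2 exp_neg_five_pi_quarter_le
  norm_num at h ⊢
  linarith

theorem exp_neg_three_pi_half_le : exp (-(3 * π * (1 / 2))) ≤ 0.0091 := by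
  have h := exp_neg_mul_natCast_div_four_le 2 exp_neg_three_pi_quarter_le
  norm_num at h ⊢
  linarith

theorem exp_neg_five_pi_three_quarters_le : exp (-(5 * π * (3 / 4))) ≤ 0.0000132 := by
  have h := exp_neg_mul_natCast_div_four_le 3 exp_neg_five_pi_quarter_le
  norm_num at h ⊢
  linarith

theorem exp_neg_three_pi_three_quarters_le : exp (-(3 * π * (3 / 4))) ≤ 0.000855 := by
  have h := exp_neg_mul_natCast_div_four_le 3 exp_neg_three_pi_quarter_le
  norm_num at h ⊢
  linarith

theorem exp_neg_five_pi_mul_le {t : ℝ} (ht : 3 / 4 ≤ t) : exp (-(5 * π * t)) ≤ 0.0000132 :=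
  le_trans (by gcongr) exp_neg_five_pi_three_quarters_le

theorem exp_neg_three_pi_mul_le {t : ℝ} (ht : 3 / 4 ≤ t) : exp (-(3 * π * t)) ≤ 0.000855 :=
  le_trans (by gcongr) exp_neg_three_pi_three_quarters_le

theorem modeMass_le_of_le (j : ℕ) {s t H r : ℝ} (hs : 0 < s) (hst : s ≤ t) (hj : j ≤ 9 * s)
    (hH : exp (-(5 * π * s)) ≤ H) (hr : exp (-(3 * π * s)) ≤ r)
    (hH1 : 9 / 4 * (8 / 3) ^ j * H < 1) :
    modeMass j t ≤ 0 ^ j + 4 * (3 * s) ^ j * r / (1 - 9 / 4 * (8 / 3) ^ j * H) :=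
  (modeMass_le_modeMass j hs hst (hj.trans (by nlinarith [pi_gt_three]))).trans
    (modeMass_le j hs hH hr hH1)

theorem modeMass_le_of_quarter_le {t : ℝ} (ht : 1 / 4 ≤ t) :
    modeMass 0 t ≤ 1.41 ∧ modeMass 1 t ≤ 0.34 := by
  constructor <;>
  exact (modeMass_le_of_le _ (by norm_num) ht (by norm_num) exp_neg_five_pi_quarter_le
    exp_neg_three_pi_quarter_le (by norm_num)).trans (by norm_num)

theorem modeMass_le_of_half_le {t : ℝ} (ht : 1 / 2 ≤ t) :
    modeMass 0 t ≤ 1.04 ∧ modeMass 1 t ≤ 0.06 := by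
  constructor <;>
  exact (modeMass_le_of_le _ (by norm_num) ht (by norm_num) exp_neg_five_pi_half_le
    exp_neg_three_pi_half_le (by norm_num)).trans (by norm_num)

theorem modeMass_le_of_three_quarters_le {t : ℝ} (ht : 3 / 4 ≤ t) :
    modeMass 0 t ≤ 1.0035 ∧ modeMass 1 t ≤ 0.0078 := by
  constructor <;>
  exact (modeMass_le_of_le _ (by norm_num) ht (by norm_num) exp_neg_five_pi_three_quarters_le
    exp_neg_three_pi_three_quarters_le (by norm_num)).trans (by norm_num)

theorem exp_neg_three_pi_mul_9458_le : exp (-(3 * π * 0.9458)) ≤ 0.0001346 :=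
  calc exp (-(3 * π * 0.9458)) ≤ exp (0.0861 - (9 : ℕ)) :=
        exp_le_exp.2 (by norm_num; linarith [pi_gt_d6])
    _ ≤ 0.0001346 := (exp_sub_natCast_le 9 (by norm_num) (by norm_num)).trans (by norm_num)

theorem modeMass_le_of_9458_le {t : ℝ} (ht : 0.9458 ≤ t) :
    modeMass 0 t ≤ 1.00054 ∧ modeMass 1 t ≤ 0.00153 := by
  constructor <;>
  exact (modeMass_le_of_le _ (by norm_num) ht (by norm_num) (exp_neg_five_pi_mul_le (by norm_num))
    exp_neg_three_pi_mul_9458_le (by norm_num)).trans (by norm_num)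

theorem modeMass_le_self {t : ℝ} (ht : 3 / 4 ≤ t) :
    modeMass 0 t ≤ 1 + 4.0004 * exp (-(3 * π * t)) ∧
      modeMass 1 t ≤ 12.0012 * (t * exp (-(3 * π * t))) := by
  have ht0 : 0 < t := by linarith
  have hr := exp_pos (-(3 * π * t))
  have htr := mul_pos ht0 hr
  have h (j : ℕ) := modeMass_le j ht0 (exp_neg_five_pi_mul_le ht) le_rfl
  constructor
  · refine (h 0 (by norm_num)).trans ?_
    norm_num
    linarith
  · refine (h 1 (by norm_num)).trans ?_
    norm_num
    linarith

theorem coeff_mul_cos_add_cos_le {X : ℝ} (Z x₁ x₂ : ℝ) (hX : 0 ≤ X) :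
    2 * (3 * X - leadCoeff X Z) * (cos (2 * π * x₁) + cos (2 * π * x₂)) ≤
      4 * |leadCoeff X Z| + 12 * X := by
  have hcos : |cos (2 * π * x₁) + cos (2 * π * x₂)| ≤ 2 :=
    (abs_add_le _ _).trans (by linarith [abs_cos_le_one (2 * π * x₁), abs_cos_le_one (2 * π * x₂)])
  have hcoeff : |3 * X - leadCoeff X Z| ≤ 3 * X + |leadCoeff X Z| :=
    (abs_sub _ _).trans_eq (by rw [abs_of_nonneg (by positivity : 0 ≤ 3 * X)])
  calc 2 * (3 * X - leadCoeff X Z) * (cos (2 * π * x₁) + cos (2 * π * x₂))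
      ≤ |2 * (3 * X - leadCoeff X Z) * (cos (2 * π * x₁) + cos (2 * π * x₂))| := le_abs_self _
    _ = 2 * |3 * X - leadCoeff X Z| * |cos (2 * π * x₁) + cos (2 * π * x₂)| := by
        rw [abs_mul, abs_mul, abs_two]
    _ ≤ 2 * (3 * X + |leadCoeff X Z|) * 2 := by gcongr
    _ = 4 * |leadCoeff X Z| + 12 * X := by ring

theorem cos_two_pi_mul_nonpos {x : ℝ} (h : 1 / 4 ≤ x) (h' : x ≤ 1 / 2) : cos (2 * π * x) ≤ 0 :=
  cos_nonpos_of_pi_div_two_le_of_le (by nlinarith [pi_pos]) (by nlinarith [pi_pos])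

theorem cos_two_pi_mul_le {x : ℝ} (h : 0.409 ≤ x) (h' : x ≤ 1 / 2) :
    cos (2 * π * x) ≤ -0.835 := by
  set t := 2 * π * (1 / 2 - x)
  have hcos : cos (2 * π * x) = -cos t := by
    rw [← cos_pi_sub]
    congr 1
    ring
  have ht : t ≤ 0.5718 :=
    calc t ≤ 2 * 3.141593 * (1 / 2 - 0.409) :=
          mul_le_mul (by linarith [pi_lt_d6]) (by linarith) (by linarith) (by norm_num)
      _ ≤ 0.5718 := by norm_num
  have ht₀ : 0 ≤ t := mul_nonneg two_pi_pos.le (by linarith)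
  have ht_sq := pow_le_pow_left₀ ht₀ ht 2
  linarith [one_sub_sq_div_two_le_cos (x := t)]

theorem mul_le_mul_exp_neg_three_pi_mul {c s t : ℝ} (ht : 1 / 4 ≤ t) (hts : t ≤ s)
    (hc : c ≤ exp (-(3 * π * s))) : s * c ≤ t * exp (-(3 * π * t)) := by
  have hmono := pow_mul_exp_neg_mul_le (a := 3 * π) 1 (by linarith) hts
    (by norm_num; nlinarith [pi_gt_three])
  simp only [pow_one] at hmono
  exact le_trans (by gcongr; linarith) hmono

theorem le_exp_neg_three_pi_mul_825 : 0.000419 ≤ exp (-(3 * π * 0.825)) :=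
  calc 0.000419 ≤ exp (0.2245 - (8 : ℕ)) :=
        le_trans (by norm_num) (le_exp_sub_natCast 8 (by norm_num))
    _ ≤ exp (-(3 * π * 0.825)) := exp_le_exp.2 (by norm_num; linarith [pi_lt_d6])

theorem le_exp_neg_three_pi_mul_8355 : 0.00038 ≤ exp (-(3 * π * 0.8355)) :=
  calc 0.00038 ≤ exp (0.1255 - (8 : ℕ)) :=
        le_trans (by norm_num) (le_exp_sub_natCast 8 (by norm_num))
    _ ≤ exp (-(3 * π * 0.8355)) := exp_le_exp.2 (by norm_num; linarith [pi_lt_d6])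

section Regimes

variable {X Z x₁ x₂ : ℝ} (h₁₂ : x₁ ≤ x₂) (h₂ : x₂ ≤ 1 / 2) (hZ : 0.9458 ≤ Z)
include h₁₂ h₂ hZ

theorem fourierSumM_le_of_large (h₁ : 0 ≤ x₁) (hX : 1 / 4 ≤ X) (hXZ : 3 / 4 ≤ X * Z)
    (hω : 0.011 ≤ leadCoeff X Z) : fourierSumM X Z x₁ ≤ fourierSumM X Z x₂ := by
  have hπ := one_div_two_pi_mem_Icc.2
  obtain ⟨hZ₀, hZ₁⟩ := modeMass_le_of_9458_le hZ
  have hX0 : 0 < X := by linarith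
  have habs : |leadCoeff X Z| = leadCoeff X Z := abs_of_nonneg (by linarith)
  have hb := coeff_mul_cos_add_cos_le Z x₁ x₂ hX0.le
  have hlead : leadCoeff X Z = Z - X - 1 / (2 * π) := rfl
  rcases le_or_gt X (1 / 2) with hX' | hX'
  · obtain ⟨hX₀, hX₁⟩ := modeMass_le_of_quarter_le hX
    refine fourierSumM_le_of_modeMass_le hX0 (by linarith) h₁ h₁₂ h₂ hX₀ hX₁ hZ₀ hZ₁ hb ?_
    have hZ' : 3 / 2 ≤ Z := by nlinarith
    rw [habs, sub_self, zero_mul]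
    linarith
  rcases le_or_gt X (3 / 4) with hX'' | hX''
  · obtain ⟨hX₀, hX₁⟩ := modeMass_le_of_half_le hX'.le
    refine fourierSumM_le_of_modeMass_le hX0 (by linarith) h₁ h₁₂ h₂ hX₀ hX₁ hZ₀ hZ₁ hb ?_
    have hZ' : 1 ≤ Z := by nlinarith
    rw [habs, sub_self, zero_mul]
    linarith
  · obtain ⟨hX₀, hX₁⟩ := modeMass_le_of_three_quarters_le hX''.le
    refine fourierSumM_le_of_modeMass_le hX0 (by linarith) h₁ h₁₂ h₂ hX₀ hX₁ hZ₀ hZ₁ hb ?_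
    rw [habs, sub_self, zero_mul]
    linarith

theorem fourierSumM_le_of_medium (h₁ : 1 / 4 ≤ x₁) (hX : 3 / 4 ≤ X)
    (hω : 0.002 ≤ leadCoeff X Z) (hω' : leadCoeff X Z ≤ 3 * X) :
    fourierSumM X Z x₁ ≤ fourierSumM X Z x₂ := by
  obtain ⟨hX₀, hX₁⟩ := modeMass_le_self hX
  obtain ⟨hZ₀, hZ₁⟩ := modeMass_le_of_9458_le hZ
  have hcos₁ := cos_two_pi_mul_nonpos h₁ (h₁₂.trans h₂)
  have hcos₂ := cos_two_pi_mul_nonpos (h₁.trans h₁₂) h₂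
  refine fourierSumM_le_of_modeMass_le (by linarith) (by linarith) (by linarith) h₁₂ h₂
    hX₀ hX₁ hZ₀ hZ₁ (mul_nonpos_of_nonneg_of_nonpos (by linarith) (by linarith)) ?_
  have hexp := exp_neg_three_pi_mul_le hX
  rw [abs_of_nonneg (by linarith : 0 ≤ leadCoeff X Z)]
  have hωexp : leadCoeff X Z * exp (-(3 * π * X)) ≤ leadCoeff X Z * 0.000855 := by gcongr
  have hXexp := pow_mul_exp_neg_mul_le (a := 3 * π) 1 (by norm_num) hX
    (by norm_num; linarith [pi_gt_three])
  have hexp₀ := exp_neg_three_pi_three_quarters_le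
  simp only [pow_one] at hXexp
  linarith

theorem fourierSumM_le_of_small (h₁ : 0.409 ≤ x₁) (hX : 3 / 4 ≤ X) (hX' : X ≤ 0.8355)
    (hω : -0.0018 ≤ leadCoeff X Z) (hω' : leadCoeff X Z ≤ 0.002)
    (hXω : 0.825 ≤ X → 0 ≤ leadCoeff X Z) : fourierSumM X Z x₁ ≤ fourierSumM X Z x₂ := by
  obtain ⟨hX₀, hX₁⟩ := modeMass_le_self hX
  obtain ⟨hZ₀, hZ₁⟩ := modeMass_le_of_9458_le hZ
  have hcos₁ := cos_two_pi_mul_le h₁ (h₁₂.trans h₂)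
  have hcos₂ := cos_two_pi_mul_le (h₁.trans h₁₂) h₂
  have hb : 2 * (3 * X - leadCoeff X Z) * (cos (2 * π * x₁) + cos (2 * π * x₂)) ≤
      2 * (3 * X - leadCoeff X Z) * -1.67 :=
    mul_le_mul_of_nonneg_left (by linarith) (by linarith)
  refine fourierSumM_le_of_modeMass_le (by linarith) (by linarith) (by linarith) h₁₂ h₂
    hX₀ hX₁ hZ₀ hZ₁ hb ?_
  have hexp := exp_neg_three_pi_mul_le hX
  rcases le_or_gt X 0.825 with h | h
  · have hXexp := mul_le_mul_exp_neg_three_pi_mul (by linarith) h le_exp_neg_three_pi_mul_825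
    have habs : |leadCoeff X Z| ≤ 0.002 := abs_le.2 ⟨by linarith, hω'⟩
    have habsexp : |leadCoeff X Z| * exp (-(3 * π * X)) ≤ 0.002 * 0.000855 := by gcongr
    have hωexp : leadCoeff X Z * exp (-(3 * π * X)) ≤ 0.002 * 0.000855 := by gcongr
    linarith
  · have hω₀ := hXω h.le
    have hXexp := mul_le_mul_exp_neg_three_pi_mul (by linarith) hX' le_exp_neg_three_pi_mul_8355
    have hωexp : leadCoeff X Z * exp (-(3 * π * X)) ≤ 0.002 * 0.000855 := by gcongr
    rw [abs_of_nonneg hω₀]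
    linarith

end Regimes

/-! ### Domination by `Γ` -/

theorem fourierSumM_le_fourierSumM {X Z x₁ x₂ : ℝ} (hX : 1 / 4 ≤ X) (hratio : X ≤ 0.838275 * Z)
    (hω : -0.0018 ≤ leadCoeff X Z) (h₁ : 0 ≤ x₁) (h₁₂ : x₁ ≤ x₂) (h₂ : x₂ ≤ 1 / 2)
    (hcircle : 1 ≤ x₁ ^ 2 + X * Z) : fourierSumM X Z x₁ ≤ fourierSumM X Z x₂ := by
  obtain ⟨hπ, hπ'⟩ := one_div_two_pi_mem_Icc
  have hlead : leadCoeff X Z = Z - X - 1 / (2 * π) := rfl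
  have hXZ : 3 / 4 ≤ X * Z := by nlinarith
  have hZ : 0.9458 ≤ Z := by nlinarith
  rcases le_or_gt 0.011 (leadCoeff X Z) with hlarge | hlarge
  · exact fourierSumM_le_of_large h₁₂ h₂ hZ h₁ hX hXZ hlarge
  have hX' : 3 / 4 ≤ X := by
    by_contra! h
    nlinarith
  rcases le_or_gt 0.002 (leadCoeff X Z) with hmedium | hsmall
  · have hXZ' : X * Z ≤ 0.883 * 1.0532 := by gcongr <;> linarith
    exact fourierSumM_le_of_medium h₁₂ h₂ hZ (by nlinarith) hX' hmedium (by linarith)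
  · have hX'' : X ≤ 0.8355 := by linarith
    have hXZ' : X * Z ≤ 0.8355 * 0.9967 := by
      gcongr
      linarith
    exact fourierSumM_le_of_small h₁₂ h₂ hZ (by nlinarith) hX' hX'' hω hsmall.le
      fun h => by linarith [hπ]

theorem latticeM_le_of_horizontal {α : ℝ} (hα : 0 < α) (hα₁ : α < 0.9155730607) {z w : ℍ}
    (him : w.im = z.im) (hw : 0 ≤ w.re) (hwz : w.re ≤ z.re) (hz : z.re ≤ 1 / 2)
    (hcircle : 1 ≤ w.re ^ 2 + z.im ^ 2) (hX : 1 / 4 ≤ α * z.im)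
    (hω : 1 / (2 * π) - 0.0018 ≤ z.im / α - α * z.im) : latticeM α w ≤ latticeM α z := by
  have hXZ : α * z.im * (z.im / α) = z.im ^ 2 := by field_simp
  have hratio : α * z.im ≤ 0.838275 * (z.im / α) :=
    have hZ := (div_pos z.im_pos hα).le
    calc α * z.im = α ^ 2 * (z.im / α) := by field_simp
      _ ≤ 0.9155730607 ^ 2 * (z.im / α) := by gcongr
      _ ≤ 0.838275 * (z.im / α) := mul_le_mul_of_nonneg_right (by norm_num) hZ
  refine latticeM_le_of_fourierSumM_le hα him
    (fourierSumM_le_fourierSumM hX hratio ?_ hw hwz hz (hXZ ▸ hcircle))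
  rw [leadCoeff]
  linarith

theorem exists_gamma_latticeM_le {α : ℝ} (hα : 0 < α) (hα₁ : α < 0.9155730607) {z : ℍ}
    (hz : z ∈ closedHalfDomain) : ∃ w ∈ gammaA ∪ gammaB, latticeM α w ≤ latticeM α z := by
  obtain ⟨hre₀, hre, hnorm⟩ := id hz
  rcases le_or_gt (α * z.im) (1 / 4) with hX | hX
  · let w : ℍ := ⟨⟨0, 1 / α⟩, one_div_pos.2 hα⟩
    have hw : w ∈ gammaA := mem_gammaA_iff.2 ⟨rfl, (one_le_div₀ hα).2 (by linarith)⟩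
    have hupper := sq_mul_latticeM_le (w := w) hα (by linarith) rfl rfl
    have hlower := le_sq_mul_latticeM hα hX (by nlinarith)
    exact ⟨w, Or.inl hw, le_of_mul_le_mul_left (by linarith) (pow_pos hα 2)⟩
  rcases lt_or_ge (z.im / α - α * z.im) (1 / (2 * π) - 0.0018) with hω | hω
  · exact ⟨UpperHalfPlane.I,
      Or.inl (mem_gammaA_iff.2 ⟨UpperHalfPlane.I_re, UpperHalfPlane.I_im.ge⟩),
      latticeM_I_le_of_near_hexagonal hα hα₁ hz hω⟩
  rcases le_or_gt 1 z.im with him | him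
  · let w : ℍ := ⟨⟨0, z.im⟩, z.im_pos⟩
    have hcircle : 1 ≤ w.re ^ 2 + z.im ^ 2 :=
      (one_le_pow₀ him).trans (le_add_of_nonneg_left (sq_nonneg _))
    exact ⟨w, Or.inl (mem_gammaA_iff.2 ⟨rfl, him⟩),
      latticeM_le_of_horizontal hα hα₁ rfl le_rfl hre₀ hre hcircle hX.le hω⟩
  · let w : ℍ := ⟨⟨√(1 - z.im ^ 2), z.im⟩, z.im_pos⟩
    have hw₀ : 0 ≤ w.re := sqrt_nonneg _
    have hwz : w.re ≤ z.re := sqrt_le_iff.2 ⟨hre₀, by linarith⟩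
    have hcircle : w.re ^ 2 + z.im ^ 2 = 1 := by
      rw [show w.re = √(1 - z.im ^ 2) from rfl,
        sq_sqrt (sub_nonneg.2 (pow_le_one₀ z.im_pos.le him.le)), sub_add_cancel]
    exact ⟨w, Or.inr (mem_gammaB_iff.2 ⟨hw₀, hwz.trans hre, hcircle⟩),
      latticeM_le_of_horizontal hα hα₁ rfl hw₀ hwz hre hcircle.ge hX.le hω⟩

theorem proposition3p1 (α : ℝ) (hα₀ : 0 < α) (hα₁ : α < 0.9155730607) :
    ∃ μ : ℝ,
      IsLeast (Set.range (latticeM α)) μ ∧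
      IsLeast (latticeM α '' closure halfFundamentalDomain) μ ∧
      IsLeast (latticeM α '' (gammaA ∪ gammaB)) μ :=
  exists_isLeast_of_forall_closedHalfDomain hα₀ fun _ hz => exists_gamma_latticeM_le hα₀ hα₁ hz
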